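/- **Setting.** Let $f_i,f_i^\dagger$ ($i\in\mathbb Z$) be charged free fermions, $[f_i,f_j^\dagger]_+=\delta_{ij}$, $[f_i,f_j]_+=[f_i^\dagger,f_j^\dagger]_+=0$, acting on the Fock space with vacuum vectors satisfying $f_i|0\rangle=f^\dagger_{-1-i}|0\rangle=0=\langle0|f_i^\dagger=\langle0|f_{-1-i}$ for $i<0$, $\langle 0|0\rangle=1$. Put $:\!xy\!:\;=xy-\langle0|xy|0\rangle$ and $$b_j=\frac{f_j+(-1)^jf^\dagger_{-j}}{\sqrt2},\qquad \hat b_j=i\,\frac{f_j-(-1)^jf^\dagger_{-j}}{\sqrt2}.$$ The map $\hat{\ }$ is the algebra homomorphism $b_j\mapsto\hat b_j$ of the (completed) Clifford algebra generated by the $b_j$. Relabel, for $f$ and likewise for $f^\dagger$, $\psi^{(1)}_i=f_{2i+1}$, $\psi^{(2)}_i=f_{2i+2}$ for $i\ge0$; $\psi^{(1)}_i=f_{2i}$, $\psi^{(2)}_i=-f_{2i+1}$ for $i<0$; and put $$\varphi=\frac{f_0+f_0^\dagger}{\sqrt2},\qquad \psi_j=\frac{\psi^{(1)}_j+\psi^{\dagger(2)}_{-1-j}}{\sqrt2},\qquad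 \psi_j^\dagger=\frac{\psi^{\dagger(1)}_j+\psi^{(2)}_{-1-j}}{\sqrt2},$$ $\beta_k=\sum_{l\in\mathbb Z}:\!\psi_l\psi^\dagger_{l+k}\!:$ and $\alpha^{(a)}_k=\sum_{l\in\mathbb Z}:\!\psi^{(a)}_l\psi^{\dagger(a)}_{l+k}\!:$ ($a=1,2$). For $n\ge0$ let $\Psi_n=\psi_{n-1}\cdots\psi_0$, $\Psi_n^\dagger=\psi_0^\dagger\cdots\psi_{n-1}^\dagger$; for $n<0$ let $\Psi_n=\psi_n^\dagger\cdots\psi_{-1}^\dagger$, $\Psi_n^\dagger=\psi_{-1}\cdots\psi_n$; define $\Psi^{(a)}_n,\Psi^{\dagger(a)}_n$ in the same way. Set $|n\rangle=\Psi_n|0\rangle$, $\langle n|=\langle0|\Psi_n^\dagger$ for even $n$; $|n\rangle=\sqrt2\,\Psi_n\varphi|0\rangle$, $\langle n|=\langle0|\varphi\Psi^\dagger_n\sqrt2$ for odd $n$; and $|n,m,0\rangle=\Psi^{(2)}_m\Psi^{(1)}_n|0\rangle$, $\langle n,m,0|=\langle0|\Psi^{\dagger(1)}_n\Psi^{\dagger(2)}_m$.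 Let $h$ be an element of (the completion of) the group $B_\infty$: an exponential $\exp\big(c+\sum_{i,j\in\mathbb Z}a_{ij}:\!b_ib_j\!:\big)$ with complex $c,a_{ij}$, or obtained from such exponentials by products and limits, where all matrix elements in the basis $\{b_{i_1}\cdots b_{i_p}\hat b_{j_1}\cdots \hat b_{j_q}f_0^{\epsilon}|0\rangle : i_1>\dots>i_p>0,\ j_1>\dots>j_q>0,\ \epsilon\in\{0,1\}\}$ converge (unconditionally for the sums in products and exponentials, entrywise for limits). Let $\hat h$ be the same expression with $b_j$ replaced by $\hat b_j$. In formal variables $s=(s_1,s_2,\dots)$, $\bar s=(\bar s_1,\bar s_2,\dots)$ define the formal power series $$\tau^B_{n,m}(s,\bar s|h)=\langle n|\,e^{\sum_{i>0}s_i\beta_i}\,h\,e^{\sum_{i>0}\bar s_i\beta_{-i}}\,|m\rangle,$$ $$\tau^{(0)}_{n,m,l}(t^{(1)},t^{(2)};\bar t^{(1)},\bar t^{(2)}|g)=\langle n,l-n,0|\,e^{\sum_{i>0}(t^{(1)}_i\alpha^{(1)}_i+t^{(2)}_i\alpha^{(2)}_i)}\,g\,e^{\sum_{i>0}(\bar t^{(1)}_i\alpha^{(1)}_{-i}+\bar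 t^{(2)}_i\alpha^{(2)}_{-i})}\,|m,l-m,0\rangle .$$ **Proposition.** For every such $h$, the element $\hat h$ and the product $g=h\hat h$ exist (all sums and limits involved converge), and for all $n,m\in\mathbb Z$, as formal power series in $s,\bar s$, $$\big(\tau^B_{n,m}(s,\bar s|h)\big)^2=(-1)^{\frac{n(n-1)}2+\frac{m(m-1)}2}\;\tau^{(0)}_{n,m,0}(s,-s;\bar s,-\bar s|g).$$ -/

import Mathlib

open Filter Topology

noncomputable section

namespace BKP

/-! ## Fock space and free fermions

A basis of the Fock space is indexed by finite sets `v ⊆ ℤ` of occupied modes.  Mode `n > 0` is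
created by the neutral fermion `b n`, mode `-n < 0` by the neutral fermion `bHat n`, and mode `0` by
the charged fermion `f 0`.  This is the Fock module of the charged fermions `f i`, `fDag i` (`i ∈ ℤ`)
below, written in the basis adapted to the two anticommuting copies of neutral fermions. -/

/-- The (right) Fock space. -/
abbrev Fock : Type := Finset ℤ →₀ ℂ

/-- The basis vector with set `v` of occupied modes. -/
def ket (v : Finset ℤ) : Fock := Finsupp.single v 1

/-- The vacuum `|0⟩`. -/
def vac : Fock := ket ∅

/-- The dual vacuum `⟨0|`; the left Fock vectors are the functionals `⟨0| A`. -/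
def vacBra : Fock →ₗ[ℂ] ℂ := Finsupp.lapply ∅

/-- The number of occupied modes below `k` (for the fermionic sign). -/
def below (k : ℤ) (v : Finset ℤ) : ℕ := (v.filter (· < k)).card

/-- Creation of the mode `k`. -/
def cr (k : ℤ) : Module.End ℂ Fock :=
  Finsupp.linearCombination ℂ fun v =>
    if k ∈ v then 0 else ((-1 : ℂ) ^ below k v) • ket (insert k v)

/-- Annihilation of the mode `k`. -/
def an (k : ℤ) : Module.End ℂ Fock :=
  Finsupp.linearCombination ℂ fun v =>
    if k ∈ v then ((-1 : ℂ) ^ below k v) • ket (v.erase k) else 0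

/-- The number `√2`. -/
def sqrtTwo : ℂ := ((Real.sqrt 2 : ℝ) : ℂ)

/-- Neutral fermions `b n`, `n ∈ ℤ`: `[b i, b j]₊ = (-1)^i δ_{i,-j}`. -/
def b (n : ℤ) : Module.End ℂ Fock :=
  if 0 < n then cr n
  else if n < 0 then ((-1 : ℂ) ^ n) • an (-n)
  else sqrtTwo⁻¹ • (cr 0 + an 0)

/-- The second copy of neutral fermions, `[bHat i, bHat j]₊ = (-1)^i δ_{i,-j}`, `[b i, bHat j]₊ = 0`.
The automorphism "hat" of the Clifford algebra of the `b n` is `b n ↦ bHat n`. -/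
def bHat (n : ℤ) : Module.End ℂ Fock :=
  if 0 < n then cr (-n)
  else if n < 0 then ((-1 : ℂ) ^ n) • an n
  else (Complex.I * sqrtTwo⁻¹) • (cr 0 - an 0)

/-- Charged fermions `f n`, so that `b n = (f n + (-1)^n fDag (-n)) / √2` and
`bHat n = i (f n - (-1)^n fDag (-n)) / √2`.  One has `f i |0⟩ = 0 = ⟨0| fDag i` for `i < 0`
and `fDag i |0⟩ = 0 = ⟨0| f i` for `i ≥ 0`. -/
def f (n : ℤ) : Module.End ℂ Fock := sqrtTwo⁻¹ • (b n - Complex.I • bHat n)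

/-- The charged fermions `f† n`, with `[f i, f† j]₊ = δ_{i,j}`. -/
def fDag (n : ℤ) : Module.End ℂ Fock :=
  ((-1 : ℂ) ^ n * sqrtTwo⁻¹) • (b (-n) + Complex.I • bHat (-n))

/-- Two-component relabelling: `ψ⁽¹⁾ i`. -/
def psi1 (i : ℤ) : Module.End ℂ Fock := if 0 ≤ i then f (2 * i + 1) else f (2 * i)

/-- `ψ†⁽¹⁾ i`. -/
def psi1Dag (i : ℤ) : Module.End ℂ Fock := if 0 ≤ i then fDag (2 * i + 1) else fDag (2 * i)

/-- `ψ⁽²⁾ i`. -/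
def psi2 (i : ℤ) : Module.End ℂ Fock := if 0 ≤ i then f (2 * i + 2) else -f (2 * i + 1)

/-- `ψ†⁽²⁾ i`. -/
def psi2Dag (i : ℤ) : Module.End ℂ Fock := if 0 ≤ i then fDag (2 * i + 2) else -fDag (2 * i + 1)

/-- `φ = (ψ + ψ†) / √2`, where `ψ = f 0`, `ψ† = fDag 0`. -/
def phi : Module.End ℂ Fock := sqrtTwo⁻¹ • (f 0 + fDag 0)

/-- `ψ j = (ψ⁽¹⁾ j + ψ†⁽²⁾ (-1-j)) / √2`. -/
def psi (j : ℤ) : Module.End ℂ Fock := sqrtTwo⁻¹ • (psi1 j + psi2Dag (-1 - j))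

/-- `ψ† j = (ψ†⁽¹⁾ j + ψ⁽²⁾ (-1-j)) / √2`. -/
def psiDag (j : ℤ) : Module.End ℂ Fock := sqrtTwo⁻¹ • (psi1Dag j + psi2 (-1 - j))

/-- Normal ordering `:x y: = x y - ⟨0| x y |0⟩` of a product of two fermions. -/
def nord (x y : Module.End ℂ Fock) : Module.End ℂ Fock := x * y - vacBra ((x * y) vac) • 1

/-- A locally finite sum of operators: on every basis vector only finitely many terms are nonzero. -/
def locSum (T : ℤ → Module.End ℂ Fock) : Module.End ℂ Fock :=
  Finsupp.linearCombination ℂ fun v => ∑ᶠ l, T l (ket v)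

/-- The current mode `∑_l :a_l a†_{l+k}:`. -/
def current (a aDag : ℤ → Module.End ℂ Fock) (k : ℤ) : Module.End ℂ Fock :=
  locSum fun l => nord (a l) (aDag (l + k))

/-- `β_k`. -/
def beta (k : ℤ) : Module.End ℂ Fock := current psi psiDag k

/-- `α⁽¹⁾_k`. -/
def alpha1 (k : ℤ) : Module.End ℂ Fock := current psi1 psi1Dag k

/-- `α⁽²⁾_k`. -/
def alpha2 (k : ℤ) : Module.End ℂ Fock := current psi2 psi2Dag k

/-- `Ψ_n = a_{n-1} ⋯ a_0` for `n ≥ 0`, and `a†_n ⋯ a†_{-1}` for `n < 0`. -/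
def Psi (a aDag : ℤ → Module.End ℂ Fock) (n : ℤ) : Module.End ℂ Fock :=
  if 0 ≤ n then ((List.range n.toNat).reverse.map fun j : ℕ => a (j : ℤ)).prod
  else ((List.range (-n).toNat).map fun j : ℕ => aDag (n + (j : ℤ))).prod

/-- `Ψ†_n = a†_0 ⋯ a†_{n-1}` for `n ≥ 0`, and `a_{-1} ⋯ a_n` for `n < 0`. -/
def PsiDag (a aDag : ℤ → Module.End ℂ Fock) (n : ℤ) : Module.End ℂ Fock :=
  if 0 ≤ n then ((List.range n.toNat).map fun j : ℕ => aDag (j : ℤ)).prod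
  else ((List.range (-n).toNat).map fun j : ℕ => a (-1 - (j : ℤ))).prod

/-- `|n⟩`: `Ψ_n |0⟩` for even `n`, and `√2 Ψ_n φ |0⟩` for odd `n`. -/
def ketB (n : ℤ) : Fock :=
  if Even n then Psi psi psiDag n vac else (sqrtTwo • (Psi psi psiDag n * phi)) vac

/-- `⟨n|`: `⟨0| Ψ†_n` for even `n`, and `⟨0| φ Ψ†_n √2` for odd `n`. -/
def braB (n : ℤ) : Fock →ₗ[ℂ] ℂ :=
  if Even n then vacBra ∘ₗ PsiDag psi psiDag n
  else vacBra ∘ₗ (sqrtTwo • (phi * PsiDag psi psiDag n))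

/-- `|n,m,0⟩ = Ψ⁽²⁾_m Ψ⁽¹⁾_n |0⟩`. -/
def ket2 (n m : ℤ) : Fock := (Psi psi2 psi2Dag m * Psi psi1 psi1Dag n) vac

/-- `⟨n,m,0| = ⟨0| Ψ†⁽¹⁾_n Ψ†⁽²⁾_m`. -/
def bra2 (n m : ℤ) : Fock →ₗ[ℂ] ℂ :=
  vacBra ∘ₗ (PsiDag psi1 psi1Dag n * PsiDag psi2 psi2Dag m)

/-! ## Infinite expressions in the fermions and the group `B_∞`

Infinite sums of products of fermions send the Fock space to its completion (all formal infinite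
combinations of basis vectors), so they are given by arbitrary infinite matrices; sums in products
and exponentials are required to converge unconditionally, entry by entry. -/

/-- Matrix elements `h v w = ⟨v| h |w⟩` of an operator from the Fock space to its completion. -/
abbrev FormalOp : Type := Finset ℤ → Finset ℤ → ℂ

/-- The matrix of an honest operator. -/
def toFormal (T : Module.End ℂ Fock) : FormalOp := fun v w => T (ket w) v

/-- The product of `A` and `B` converges, and its value is `D`. -/
def IsProd (A B D : FormalOp) : Prop :=
  ∀ v w, HasSum (fun u => A v u * B u w) (D v w)

/-- The exponential series of `Z` converges, and its value is `E` (`P k` is the power `Z ^ k`). -/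
def IsExp (Z E : FormalOp) : Prop :=
  ∃ P : ℕ → FormalOp, P 0 = toFormal 1 ∧ (∀ k, IsProd Z (P k) (P (k + 1))) ∧
    ∀ v w, HasSum (fun k : ℕ => P k v w / (k.factorial : ℂ)) (E v w)

/-- `c + ∑_{i,j ∈ ℤ} a_{ij} :e_i e_j:` for arbitrary complex numbers `c`, `a_{ij}`; for neutral
fermions `e` every matrix element is a finite sum. -/
def quadratic (e : ℤ → Module.End ℂ Fock) (c : ℂ) (a : ℤ → ℤ → ℂ) : FormalOp := fun v w =>
  c * toFormal 1 v w + ∑ᶠ p : ℤ × ℤ, a p.1 p.2 * toFormal (nord (e p.1) (e p.2)) v w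

/-- Expressions for elements of (the completion of) the group `B_∞`: exponentials
`exp (c + ∑_{i,j ∈ ℤ} a_{ij} :e_i e_j:)`, products of such, and limits. -/
inductive GroupExpr : Type
  | exp (c : ℂ) (a : ℤ → ℤ → ℂ) : GroupExpr
  | mul (x y : GroupExpr) : GroupExpr
  | lim (x : ℕ → GroupExpr) : GroupExpr

/-- `Value e x h`: all sums and limits in the expression `x` converge when the neutral fermions `e`
are inserted in it, and the resulting operator is `h`. -/
inductive Value (e : ℤ → Module.End ℂ Fock) : GroupExpr → FormalOp → Prop
  | exp (c : ℂ) (a : ℤ → ℤ → ℂ) (h : FormalOp) (hh : IsExp (quadratic e c a) h) :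
      Value e (GroupExpr.exp c a) h
  | mul (x y : GroupExpr) (h₁ h₂ h : FormalOp) (hx : Value e x h₁) (hy : Value e y h₂)
      (hh : IsProd h₁ h₂ h) : Value e (GroupExpr.mul x y) h
  | lim (x : ℕ → GroupExpr) (H : ℕ → FormalOp) (h : FormalOp) (hx : ∀ k, Value e (x k) (H k))
      (hh : ∀ v w, Tendsto (fun k => H k v w) atTop (𝓝 (h v w))) : Value e (GroupExpr.lim x) h

/-! ## Time evolution and tau functions

Everything is a formal power series in the higher times.  A family of times is given by its values
`t i` (`i = 1, 2, …`), which are power series in some underlying variables. -/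

/-- `∑_{i>0} t_i A_i` as a power series whose coefficients are operators. -/
def flow {σ : Type*} (t : ℕ+ → MvPowerSeries σ ℂ) (A : ℕ+ → Module.End ℂ Fock) :
    MvPowerSeries σ (Module.End ℂ Fock) :=
  fun μ => ∑ᶠ i, MvPowerSeries.coeff μ (t i) • A i

/-- The exponential series of a power series without constant term. -/
def expSeries {σ : Type*} (Y : MvPowerSeries σ (Module.End ℂ Fock)) :
    MvPowerSeries σ (Module.End ℂ Fock) :=
  fun μ => ∑ k ∈ Finset.range (μ.degree + 1),
    ((k.factorial : ℂ)⁻¹) • MvPowerSeries.coeff μ (Y ^ k)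

/-- `⟨ℓ| h |x⟩`.  (For the left vectors `ℓ` used here the sum over `v` is finite.) -/
def pairing (l : Fock →ₗ[ℂ] ℂ) (h : FormalOp) (x : Fock) : ℂ :=
  ∑ᶠ v, l (ket v) * x.sum fun w c => h v w * c

/-- The power series `⟨ℓ| L · h · R |x⟩`, for power series `L`, `R` with operator coefficients. -/
def matrixElement {σ : Type*} [DecidableEq σ] (l : Fock →ₗ[ℂ] ℂ)
    (L : MvPowerSeries σ (Module.End ℂ Fock)) (h : FormalOp)
    (R : MvPowerSeries σ (Module.End ℂ Fock)) (x : Fock) : MvPowerSeries σ ℂ :=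
  fun μ => ∑ p ∈ Finset.HasAntidiagonal.antidiagonal μ,
    pairing (l ∘ₗ MvPowerSeries.coeff p.1 L) h (MvPowerSeries.coeff p.2 R x)

/-- The 2-BKP tau function `τ^B_{n,m}(s, s̄ | h)`. -/
def tauB {σ : Type*} [DecidableEq σ] (n m : ℤ) (s sbar : ℕ+ → MvPowerSeries σ ℂ)
    (h : FormalOp) : MvPowerSeries σ ℂ :=
  matrixElement (braB n)
    (expSeries (flow s fun i => beta ((i : ℕ) : ℤ))) h
    (expSeries (flow sbar fun i => beta (-((i : ℕ) : ℤ)))) (ketB m)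

/-- The two-component 2-KP tau function `τ^{(0)}_{n,m,l}(t₁, t₂; t̄₁, t̄₂ | g)`. -/
def tau2KP {σ : Type*} [DecidableEq σ] (n m l : ℤ) (t₁ t₂ tbar₁ tbar₂ : ℕ+ → MvPowerSeries σ ℂ)
    (g : FormalOp) : MvPowerSeries σ ℂ :=
  matrixElement (bra2 n (l - n))
    (expSeries (flow t₁ (fun i => alpha1 ((i : ℕ) : ℤ)) +
      flow t₂ (fun i => alpha2 ((i : ℕ) : ℤ)))) g
    (expSeries (flow tbar₁ (fun i => alpha1 (-((i : ℕ) : ℤ))) +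
      flow tbar₂ (fun i => alpha2 (-((i : ℕ) : ℤ))))) (ket2 m (l - m))

/-- The left times `s_1, s_2, …` as independent variables. -/
def sVar (i : ℕ+) : MvPowerSeries (ℕ+ ⊕ ℕ+) ℂ := MvPowerSeries.X (Sum.inl i)

/-- The right times `s̄_1, s̄_2, …` as independent variables. -/
def sbarVar (i : ℕ+) : MvPowerSeries (ℕ+ ⊕ ℕ+) ℂ := MvPowerSeries.X (Sum.inr i)

end BKP

end

/-! The Fock space carries two anticommuting copies of the neutral fermions: `b n` toggles the mode
`|n|`, `bHat n` the mode `-|n|`, and only the mode `0` is shared. The proof shows that every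
ingredient of the two-component KP matrix element of `g = h ĥ` is, up to a sign, a product of an
element of the `b`-algebra and its hat, and that the matrix elements of `h ĥ` between such products
factorize.

The hat is conjugation by an explicit rotation `rot`, which reflects `v` to `-v` with signs and a
factor `i` for the mode `0`. Hence convergence of `h` transports at once to `ĥ` (`Value.hatFormal`),
and matrix elements of `ĥ` between rotated vectors equal those of `h` (`form_hatFormal`).

Factorization (`form_prodFormal_words`) uses only commutation. An operator commuting with all `b i *
b j` commutes with `h`, since that is an entrywise identity stable under sums, products and limits
(`Value.commMono`); for monomial operators it involves a single entry on each side. Insert a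
complete set of states between `h` and `ĥ`. Even words in `bHat` pass through `h`, even words in `b`
through `ĥ`. Conserved occupations exclude intermediate states with a nonzero mode occupied, and
parity excludes the state with only mode `0`, so only the vacuum remains. The same conservation laws
make the product `h ĥ` a finite sum.

Factorization extends by linearity to even polynomials and then, as each vector sees only finitely
many terms, to their pointwise closure `localAlg`, which contains the currents.

It remains to rewrite the two-component data. For `k ≠ 0`, `alpha1 k - alpha2 k` is `beta k` plus
its hat (`alpha_sub`); the two summands commute, so the time evolutions at times `s, -s` factor
(`expSeries_flow_alpha`). The charged vacua factor with a power of `-i` (`bra2_eq`, `ket2_eq`),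
which for odd charge combines with `φ φ̂ = i/2` on the vacuum to give the sign `(-1)^{n(n-1)/2}`. -/

namespace BKP

noncomputable section


/-! ## Monomial operators -/

/-- The operator `ket v ↦ c v • ket (v ∆ D)`. -/
def mono (D : Finset ℤ) (c : Finset ℤ → ℂ) : Module.End ℂ Fock :=
  Finsupp.linearCombination ℂ fun v => c v • ket (symmDiff v D)

theorem mono_ket (D : Finset ℤ) (c : Finset ℤ → ℂ) (v : Finset ℤ) :
    mono D c (ket v) = c v • ket (symmDiff v D) := by
  simp [mono, ket]

theorem end_ext {A B : Module.End ℂ Fock} (h : ∀ v, A (ket v) = B (ket v)) : A = B :=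
  Finsupp.lhom_ext' fun v => LinearMap.ext_ring (h v)

theorem ket_apply (v w : Finset ℤ) : ket v w = if v = w then 1 else 0 := by
  simp [ket, Finsupp.single_apply]

theorem mono_mul (D D' : Finset ℤ) (c c' : Finset ℤ → ℂ) :
    mono D c * mono D' c' = mono (symmDiff D D') fun v => c' v * c (symmDiff v D') := by
  refine end_ext fun v => ?_
  rw [Module.End.mul_apply, mono_ket, map_smul, mono_ket, mono_ket, smul_smul, symmDiff_assoc,
    symmDiff_comm D' D]

theorem mono_one : mono ∅ (fun _ => 1) = 1 := by
  refine end_ext fun v => ?_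
  simp [mono_ket, ← Finset.bot_eq_empty]

theorem mono_smul (z : ℂ) (D : Finset ℤ) (c : Finset ℤ → ℂ) :
    z • mono D c = mono D fun v => z * c v := by
  refine end_ext fun v => ?_
  simp [mono_ket, smul_smul]

theorem mono_add (D : Finset ℤ) (c c' : Finset ℤ → ℂ) :
    mono D c + mono D c' = mono D fun v => c v + c' v := by
  refine end_ext fun v => ?_
  simp [mono_ket, add_smul]

theorem mono_apply (D : Finset ℤ) (c : Finset ℤ → ℂ) (x : Fock) (v : Finset ℤ) :
    mono D c x v = c (symmDiff v D) * x (symmDiff v D) := by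
  induction x using Finsupp.induction_linear with
  | zero => simp
  | add x y hx hy => simp only [map_add, Finsupp.add_apply, hx, hy, mul_add]
  | single w z =>
    have : Finsupp.single w z = z • ket w := by simp [ket]
    rw [this, map_smul, mono_ket]
    simp only [Finsupp.smul_apply, smul_eq_mul, ket_apply]
    by_cases h : w = symmDiff v D
    · subst h
      simp only [symmDiff_symmDiff_cancel_right, if_true]; ring
    · have h' : symmDiff w D ≠ v := fun h' => h (by rw [← h', symmDiff_symmDiff_cancel_right])
      simp [h, h']

/-- The fermionic sign of the mode `k`. -/
def sgn (k : ℤ) (v : Finset ℤ) : ℂ := (-1) ^ below k v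

theorem sgn_mul_self (k : ℤ) (v : Finset ℤ) : sgn k v * sgn k v = 1 := by
  simp [sgn, ← mul_pow]

theorem mem_toggle (j k : ℤ) (v : Finset ℤ) : j ∈ symmDiff v {k} ↔ (j = k ∧ k ∉ v ∨ j ≠ k ∧ j ∈ v) := by
  rw [Finset.mem_symmDiff, Finset.mem_singleton]
  constructor
  · rintro (⟨h, h'⟩ | ⟨h, h'⟩)
    · exact Or.inr ⟨h', h⟩
    · subst h; exact Or.inl ⟨rfl, h'⟩
  · rintro (⟨rfl, h⟩ | ⟨h, h'⟩)
    · exact Or.inr ⟨rfl, h⟩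
    · exact Or.inl ⟨h', h⟩

theorem toggle_of_mem {k : ℤ} {v : Finset ℤ} (h : k ∈ v) : symmDiff v {k} = v.erase k := by
  ext j; rw [mem_toggle, Finset.mem_erase]; tauto

theorem toggle_of_notMem {k : ℤ} {v : Finset ℤ} (h : k ∉ v) : symmDiff v {k} = insert k v := by
  ext j; rw [mem_toggle, Finset.mem_insert]
  by_cases hj : j = k <;> simp [hj, h]

theorem sgn_insert {k j : ℤ} {v : Finset ℤ} (h : j ∉ v) :
    sgn k (insert j v) = (if j < k then -1 else 1) * sgn k v := by
  unfold sgn below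
  rw [Finset.filter_insert]
  split_ifs with hj
  · rw [Finset.card_insert_of_notMem (by simp [h]), pow_succ]; ring
  · ring

theorem sgn_toggle (k j : ℤ) (v : Finset ℤ) :
    sgn k (symmDiff v {j}) = (if j < k then -1 else 1) * sgn k v := by
  by_cases h : j ∈ v
  · rw [toggle_of_mem h]
    conv_rhs => rw [← Finset.insert_erase h, sgn_insert (Finset.notMem_erase j v)]
    split_ifs <;> ring
  · rw [toggle_of_notMem h, sgn_insert h]

/-- The operator toggling the mode `k`: it annihilates with weight `p` and creates with weight `q`. -/
def toggleOp (k : ℤ) (p q : ℂ) : Module.End ℂ Fock :=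
  mono {k} fun v => (if k ∈ v then p else q) * sgn k v

theorem toggleOp_ket (k : ℤ) (p q : ℂ) (v : Finset ℤ) :
    toggleOp k p q (ket v) = ((if k ∈ v then p else q) * sgn k v) • ket (symmDiff v {k}) :=
  mono_ket _ _ _

theorem cr_eq (k : ℤ) : cr k = toggleOp k 0 1 := by
  refine end_ext fun v => ?_
  rw [toggleOp_ket]
  by_cases h : k ∈ v <;> simp [cr, ket, h, sgn, toggle_of_notMem]

theorem an_eq (k : ℤ) : an k = toggleOp k 1 0 := by
  refine end_ext fun v => ?_
  rw [toggleOp_ket]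
  by_cases h : k ∈ v <;> simp [an, ket, h, sgn, toggle_of_mem]

theorem toggleOp_smul (z : ℂ) (k : ℤ) (p q : ℂ) :
    z • toggleOp k p q = toggleOp k (z * p) (z * q) := by
  unfold toggleOp
  rw [mono_smul]; congr 1; ext v; split_ifs <;> ring

theorem toggleOp_add (k : ℤ) (p q p' q' : ℂ) :
    toggleOp k p q + toggleOp k p' q' = toggleOp k (p + p') (q + q') := by
  unfold toggleOp
  rw [mono_add]; congr 1; ext v; split_ifs <;> ring

/-- `A` and `B` anticommute. -/
def Anticomm {R : Type*} [NonUnitalNonAssocSemiring R] (A B : R) : Prop := A * B + B * A = 0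

theorem mono_eq_zero (D : Finset ℤ) {c : Finset ℤ → ℂ} (h : ∀ v, c v = 0) : mono D c = 0 :=
  end_ext fun v => by simp [mono_ket, h]

theorem toggleOp_anticomm {j k : ℤ} (h : j ≠ k) (p q p' q' : ℂ) :
    Anticomm (toggleOp j p q) (toggleOp k p' q') := by
  unfold toggleOp Anticomm
  rw [mono_mul, mono_mul, symmDiff_comm, mono_add]
  refine mono_eq_zero _ fun v => ?_
  have h1 : j ∈ symmDiff v {k} ↔ j ∈ v := by rw [mem_toggle]; tauto
  have h2 : k ∈ symmDiff v {j} ↔ k ∈ v := by rw [mem_toggle]; have := h.symm; tauto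
  simp only [h1, h2, sgn_toggle]
  rcases lt_or_gt_of_ne h with hl | hl
  · rw [if_neg (not_lt.2 hl.le), if_pos hl]; ring
  · rw [if_pos hl, if_neg (not_lt.2 hl.le)]; ring

theorem toggleOp_mul_self (k : ℤ) (p q p' q' : ℂ) :
    toggleOp k p q * toggleOp k p' q' = mono ∅ fun v => if k ∈ v then q * p' else p * q' := by
  unfold toggleOp
  rw [mono_mul, symmDiff_self, Finset.bot_eq_empty]
  congr 1; ext v
  have h1 : k ∈ symmDiff v {k} ↔ k ∉ v := by rw [mem_toggle]; tauto
  simp only [h1, sgn_toggle, lt_irrefl, if_false]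
  have := sgn_mul_self k v
  by_cases hk : k ∈ v <;> simp only [hk, if_true, if_false, not_true, not_false_iff]
  · linear_combination (q * p') * this
  · linear_combination (p * q') * this

/-- Annihilation weight of `b n`. -/
def bAnn (n : ℤ) : ℂ := if 0 < n then 0 else if n < 0 then (-1) ^ n else sqrtTwo⁻¹
/-- Creation weight of `b n`. -/
def bCre (n : ℤ) : ℂ := if 0 < n then 1 else if n < 0 then 0 else sqrtTwo⁻¹
/-- The phases by which `bHat` differs from `b`. -/
def phase (n : ℤ) : ℂ := if n = 0 then Complex.I else 1

theorem phase_ne_zero (n : ℤ) : phase n ≠ 0 := by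
  unfold phase; split_ifs <;> simp

theorem b_eq (n : ℤ) : b n = toggleOp |n| (bAnn n) (bCre n) := by
  unfold b bAnn bCre
  split_ifs with h h'
  · rw [cr_eq, abs_of_pos h]
  · rw [an_eq, abs_of_neg h', toggleOp_smul]; simp
  · have : n = 0 := by omega
    rw [cr_eq, an_eq, toggleOp_add, toggleOp_smul, this]; simp

theorem bHat_eq (n : ℤ) :
    bHat n = toggleOp (-|n|) ((phase n)⁻¹ * bAnn n) (phase n * bCre n) := by
  unfold bHat bAnn bCre phase
  rcases lt_trichotomy n 0 with h | h | h
  · have h1 : ¬ 0 < n := h.not_gt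
    have h2 : n ≠ 0 := h.ne
    simp only [h1, h, h2, if_true, if_false, an_eq, abs_of_neg h, toggleOp_smul]; simp
  · have : cr 0 - an 0 = cr 0 + (-1 : ℂ) • an 0 := end_ext fun v => by
      simp [sub_eq_add_neg]
    subst h
    simp only [lt_irrefl, if_false, if_true]
    rw [this, cr_eq, an_eq, toggleOp_smul, toggleOp_add, toggleOp_smul]
    simp
  · have h2 : n ≠ 0 := h.ne'
    simp only [h, h2, if_true, if_false, cr_eq, abs_of_pos h]; simp

theorem b_bHat_anticomm (m n : ℤ) : Anticomm (b m) (bHat n) := by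
  rw [b_eq, bHat_eq]
  -- The toggled modes coincide only for `m = n = 0`; there the factors `i` and `i⁻¹` on creation
  -- and annihilation make the two products cancel.
  by_cases h : |m| = -|n|
  · have hm : m = 0 := by have := abs_nonneg m; have := abs_nonneg n; exact abs_eq_zero.1 (by omega)
    have hn : n = 0 := by have := abs_nonneg m; have := abs_nonneg n; exact abs_eq_zero.1 (by omega)
    subst hm hn
    simp only [Anticomm, abs_zero, neg_zero, toggleOp_mul_self, phase, bAnn, bCre, mono_add]
    refine mono_eq_zero _ fun v => ?_
    simp
    split_ifs <;> ring
  · exact toggleOp_anticomm h _ _ _ _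

theorem b_anticomm {m n : ℤ} (h : m + n ≠ 0) : Anticomm (b m) (b n) := by
  rw [b_eq, b_eq]
  by_cases hmn : |m| = |n|
  · have : m = n := by rcases abs_eq_abs.1 hmn with h' | h' <;> omega
    subst this
    have hm : m ≠ 0 := by omega
    unfold Anticomm
    rw [toggleOp_mul_self, mono_add]
    refine mono_eq_zero _ fun v => ?_
    unfold bCre bAnn
    rcases lt_or_gt_of_ne hm with h' | h'
    · simp [h', h'.not_gt]
    · simp [h']
  · exact toggleOp_anticomm hmn _ _ _ _

theorem bAnn_neg (n : ℤ) : bAnn (-n) = (-1) ^ n * bCre n := by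
  unfold bAnn bCre
  rcases lt_trichotomy n 0 with h | h | h
  · simp [h, not_lt.2 h.le]
  · subst h; simp
  · simp [h, not_lt.2 h.le, ← inv_zpow]

theorem bCre_neg (n : ℤ) : bCre (-n) = (-1) ^ n * bAnn n := by
  have := bAnn_neg (-n)
  rw [neg_neg] at this
  rw [this, ← mul_assoc, ← zpow_add₀ (by norm_num)]; simp

/-! ## Transposes -/

/-- `A` and `B` are transposes of each other. -/
def IsTranspose (A B : Module.End ℂ Fock) : Prop := ∀ v w, A (ket w) v = B (ket v) w

theorem mono_isTranspose (D : Finset ℤ) (c : Finset ℤ → ℂ) :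
    IsTranspose (mono D c) (mono D fun v => c (symmDiff v D)) := by
  intro v w
  rw [mono_apply, mono_apply, symmDiff_symmDiff_cancel_right, ket_apply, ket_apply]
  by_cases h : w = symmDiff v D
  · subst h; simp
  · have : v ≠ symmDiff w D := fun h' => h (by rw [h', symmDiff_symmDiff_cancel_right])
    simp [h, this]

theorem toggleOp_isTranspose (k : ℤ) (p q : ℂ) :
    IsTranspose (toggleOp k p q) (toggleOp k q p) := by
  have : toggleOp k q p = mono {k} fun v => (if k ∈ symmDiff v {k} then p else q) *
      sgn k (symmDiff v {k}) := by
    unfold toggleOp; congr 1; ext v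
    have h1 : k ∈ symmDiff v {k} ↔ k ∉ v := by rw [mem_toggle]; tauto
    simp only [h1, sgn_toggle, lt_irrefl, if_false]
    by_cases hk : k ∈ v <;> simp [hk]
  rw [this]; exact mono_isTranspose _ _

theorem IsTranspose.symm {A B : Module.End ℂ Fock} (h : IsTranspose A B) : IsTranspose B A :=
  fun v w => (h w v).symm

theorem IsTranspose.eq {A B C : Module.End ℂ Fock} (h : IsTranspose A B) (h' : IsTranspose A C) :
    B = C :=
  end_ext fun v => Finsupp.ext fun w => (h v w).symm.trans (h' v w)

theorem IsTranspose.one : IsTranspose 1 1 := fun v w => by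
  simp [ket_apply, eq_comm]

theorem IsTranspose.add {A B A' B' : Module.End ℂ Fock} (h : IsTranspose A B)
    (h' : IsTranspose A' B') : IsTranspose (A + A') (B + B') := fun v w => by
  simp [h v w, h' v w]

theorem IsTranspose.smul {A B : Module.End ℂ Fock} (h : IsTranspose A B) (z : ℂ) :
    IsTranspose (z • A) (z • B) := fun v w => by
  simp [h v w]

theorem apply_eq_sum (A : Module.End ℂ Fock) (x : Fock) (v : Finset ℤ) :
    A x v = x.sum fun u z => z * A (ket u) v := by
  conv_lhs => rw [← Finsupp.sum_single x]
  rw [Finsupp.sum, map_sum, Finsupp.finsetSum_apply, Finsupp.sum]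
  refine Finset.sum_congr rfl fun u _ => ?_
  have : Finsupp.single u (x u) = x u • ket u := by simp [ket]
  rw [this, map_smul]; rfl

theorem IsTranspose.sum_mul {A B : Module.End ℂ Fock} (h : IsTranspose A B) (x : Fock)
    (v : Finset ℤ) : A x v = (B (ket v)).sum fun u z => x u * z := by
  rw [apply_eq_sum]
  rw [Finsupp.sum_of_support_subset x (Finset.subset_union_left (s₂ := (B (ket v)).support)) _ (by simp),
    Finsupp.sum_of_support_subset _ (Finset.subset_union_right (s₁ := x.support)) _ (by simp)]
  exact Finset.sum_congr rfl fun u _ => by rw [h v u]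

theorem IsTranspose.mul {A B A' B' : Module.End ℂ Fock} (h : IsTranspose A B)
    (h' : IsTranspose A' B') : IsTranspose (A * A') (B' * B) := fun v w => by
  rw [Module.End.mul_apply, Module.End.mul_apply, h.sum_mul, apply_eq_sum]
  refine Finsupp.sum_congr fun u _ => ?_
  rw [h' u w, mul_comm]

theorem b_isTranspose (n : ℤ) : IsTranspose (b n) ((-1 : ℂ) ^ n • b (-n)) := by
  rw [b_eq, b_eq, toggleOp_smul, abs_neg, bAnn_neg, bCre_neg, ← mul_assoc, ← mul_assoc,
    ← zpow_add₀ (by norm_num), (Even.add_self n).neg_one_zpow, one_mul, one_mul]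
  exact toggleOp_isTranspose _ _ _

/-- The scalar is left unspecified because it differs from that of `b` at `n = 0`, where the phase
`i` squares to `-1`. Only proportionality is used later. -/
theorem bHat_isTranspose (n : ℤ) :
    ∃ z : ℂ, IsTranspose (bHat n) (z • bHat (-n)) := by
  refine ⟨(-1 : ℂ) ^ n * (phase n * phase n), ?_⟩
  have hp : phase (-n) = phase n := by simp [phase]
  have hp' : (phase n * phase n) * (phase n * phase n) = 1 := by
    unfold phase; split_ifs <;> simp
  rw [bHat_eq, bHat_eq, toggleOp_smul, abs_neg, bAnn_neg, bCre_neg, hp]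
  have h1 : ((-1 : ℂ) ^ n) * (-1) ^ n = 1 := by
    rw [← zpow_add₀ (by norm_num), (Even.add_self n).neg_one_zpow]
  have h0 := phase_ne_zero n
  convert toggleOp_isTranspose _ _ _ using 2
  · field_simp
    linear_combination (bCre n) * h1
  · rw [eq_inv_mul_iff_mul_eq₀ h0]
    linear_combination bAnn n * (phase n * phase n) * (phase n * phase n) * h1 + bAnn n * hp'


/-! ## Operators commuting with a group element -/

/-- The formal operator `h` commutes with `mono D c`. -/
def CommMono (h : FormalOp) (D : Finset ℤ) (c : Finset ℤ → ℂ) : Prop :=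
  ∀ v w, c w * h v (symmDiff w D) = c (symmDiff v D) * h (symmDiff v D) w

theorem commMono_toFormal {T : Module.End ℂ Fock} {D : Finset ℤ} {c : Finset ℤ → ℂ}
    (hT : Commute (mono D c) T) : CommMono (toFormal T) D c := by
  intro v w
  have h := congrArg (fun A : Module.End ℂ Fock => A (ket w) v) hT.eq
  simp only [Module.End.mul_apply, mono_apply, mono_ket, map_smul, Finsupp.smul_apply,
    smul_eq_mul] at h
  exact h.symm

/-- The involution `v ↦ v ∆ D`. -/
def toggleEquiv (D : Finset ℤ) : Finset ℤ ≃ Finset ℤ where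
  toFun v := symmDiff v D
  invFun v := symmDiff v D
  left_inv _ := symmDiff_symmDiff_cancel_right _ _
  right_inv _ := symmDiff_symmDiff_cancel_right _ _

/-- A monomial operator has at most one nonzero entry in each row and column, so moving it through
`A` and then `B` is a termwise identity after toggling the summation index. Uniqueness of sums
finishes, and no convergence beyond that of `A B` is needed. -/
theorem IsProd.commMono {A B E : FormalOp} {D : Finset ℤ} {c : Finset ℤ → ℂ} (h : IsProd A B E)
    (hA : CommMono A D c) (hB : CommMono B D c) : CommMono E D c := by
  intro v w
  have h1 := (h v (symmDiff w D)).mul_left (c w)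
  have h2 := (h (symmDiff v D) w).mul_left (c (symmDiff v D))
  rw [← (toggleEquiv D).hasSum_iff] at h1
  refine h1.unique ?_
  convert h2 using 1
  ext u
  have hA' := hA v u
  have hB' := hB (symmDiff u D) w
  rw [symmDiff_symmDiff_cancel_right] at hB'
  simp only [Function.comp_apply, toggleEquiv, Equiv.coe_fn_mk]
  linear_combination A v (symmDiff u D) * hB' + B u w * hA'

theorem quadratic_commMono {e : ℤ → Module.End ℂ Fock} {D : Finset ℤ} {c : Finset ℤ → ℂ}
    (he : ∀ i j, Commute (mono D c) (e i * e j)) (z : ℂ) (a : ℤ → ℤ → ℂ) :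
    CommMono (quadratic e z a) D c := by
  intro v w
  have h1 := commMono_toFormal (Commute.one_right (mono D c)) v w
  have h2 : ∀ p : ℤ × ℤ, c w * (a p.1 p.2 * toFormal (nord (e p.1) (e p.2)) v (symmDiff w D)) =
      c (symmDiff v D) * (a p.1 p.2 * toFormal (nord (e p.1) (e p.2)) (symmDiff v D) w) := by
    intro p
    have : Commute (mono D c) (nord (e p.1) (e p.2)) := by
      have h3 := he p.1 p.2
      refine end_ext fun u => ?_
      have h4 := congrArg (fun A : Module.End ℂ Fock => A (ket u)) h3.eq
      simp only [Module.End.mul_apply] at h4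
      simp [nord, map_sub, h4]
    have h3 := commMono_toFormal this v w
    linear_combination a p.1 p.2 * h3
  unfold quadratic
  rw [mul_add, mul_add]
  congr 1
  · linear_combination z * h1
  -- Over a field a constant comes out of `∑ᶠ` whether or not the support is finite.
  · rw [← smul_eq_mul (c w), ← smul_eq_mul (c _), smul_finsum, smul_finsum]
    exact finsum_congr h2

theorem IsExp.commMono {Z E : FormalOp} {D : Finset ℤ} {c : Finset ℤ → ℂ} (h : IsExp Z E)
    (hZ : CommMono Z D c) : CommMono E D c := by
  obtain ⟨P, h0, hs, hE⟩ := h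
  have hP : ∀ k, CommMono (P k) D c := by
    intro k
    induction k with
    | zero => rw [h0]; exact commMono_toFormal (Commute.one_right _)
    | succ k ih => exact (hs k).commMono hZ ih
  intro v w
  refine ((hE v _).mul_left (c w)).unique ?_
  convert (hE _ w).mul_left (c (symmDiff v D)) using 1
  ext k
  rw [← mul_div_assoc, ← mul_div_assoc, hP k v w]

/-- This is the only property of the group element that the factorization uses: being an equality
between multiples of single entries, commutation survives exponentials, products and entrywise
limits. -/
theorem Value.commMono {e : ℤ → Module.End ℂ Fock} {x : GroupExpr} {h : FormalOp}
    (hx : Value e x h) {D : Finset ℤ} {c : Finset ℤ → ℂ}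
    (he : ∀ i j, Commute (mono D c) (e i * e j)) : CommMono h D c := by
  induction hx with
  | exp z a h hh => exact hh.commMono (quadratic_commMono he z a)
  | mul x y h₁ h₂ h _ _ hh ih₁ ih₂ => exact hh.commMono ih₁ ih₂
  | lim x H h _ hh ih =>
    intro v w
    refine tendsto_nhds_unique ((hh v _).const_mul (c w)) ?_
    simp only [fun k => ih k v w]
    exact (hh _ w).const_mul _

/-! ## The hat automorphism -/

/-- The reflection `v ↦ -v`. -/
def refl : Finset ℤ ≃ Finset ℤ := Equiv.finsetCongr (Equiv.neg ℤ)

theorem mem_refl {v : Finset ℤ} {k : ℤ} : k ∈ refl v ↔ -k ∈ v := by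
  simp [refl, Finset.mem_map_equiv]

theorem refl_refl (v : Finset ℤ) : refl (refl v) = v := by
  ext k; simp [mem_refl]

theorem refl_symmDiff (v : Finset ℤ) (k : ℤ) : refl (symmDiff v {k}) = symmDiff (refl v) {-k} := by
  ext j
  rw [mem_refl, Finset.mem_symmDiff, Finset.mem_symmDiff, mem_refl, Finset.mem_singleton,
    Finset.mem_singleton, neg_eq_iff_eq_neg]

/-- The weight by which the basis vector `ket v` is multiplied under the reflection of modes. -/
def theta (ε : ℤ → ℂ) (v : Finset ℤ) : ℂ := (-1) ^ (v.card.choose 2) * ∏ j ∈ v, ε j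

theorem theta_ne_zero {ε : ℤ → ℂ} (hε : ∀ k, ε k ≠ 0) (v : Finset ℤ) : theta ε v ≠ 0 :=
  mul_ne_zero (pow_ne_zero _ (by norm_num)) (Finset.prod_ne_zero_iff.2 fun j _ => hε j)

theorem theta_empty (ε : ℤ → ℂ) : theta ε ∅ = 1 := by simp [theta]

theorem theta_inv (ε : ℤ → ℂ) (v : Finset ℤ) : theta ε⁻¹ v = (theta ε v)⁻¹ := by
  unfold theta
  rw [mul_inv, ← inv_pow, ← Finset.prod_inv_distrib, inv_neg_one]
  rfl

/-- Reflection reverses the order of the modes, which costs `(-1)^(card choose 2)`. Adding `k`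
raises that exponent by `v.card`, the number of modes below `k` plus the number above, and the
latter lie below `-k` after reflection. -/
theorem theta_insert (ε : ℤ → ℂ) {k : ℤ} {v : Finset ℤ} (h : k ∉ v) :
    theta ε (insert k v) * sgn k v = ε k * theta ε v * sgn (-k) (refl v) := by
  have hcard : v.card = below k v + below (-k) (refl v) := by
    unfold below
    have h1 : ((refl v).filter (· < -k)).card = (v.filter (k < ·)).card := by
      have : (refl v).filter (· < -k) = refl (v.filter (k < ·)) := by
        ext j; simp only [Finset.mem_filter, mem_refl, lt_neg]
      rw [this]; simp [refl]
    rw [h1, ← Finset.card_union_of_disjoint]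
    · congr 1; ext j
      simp only [Finset.mem_union, Finset.mem_filter]
      constructor
      · intro hj
        rcases lt_trichotomy j k with h' | h' | h'
        · exact Or.inl ⟨hj, h'⟩
        · subst h'; exact absurd hj h
        · exact Or.inr ⟨hj, h'⟩
      · rintro (h' | h') <;> exact h'.1
    · rw [Finset.disjoint_left]
      intro j hj hj'
      simp only [Finset.mem_filter] at hj hj'
      omega
  unfold theta
  have hc : (v.card + 1).choose 2 = v.card.choose 2 + v.card := by
    rw [Nat.choose_succ_succ' v.card 1, Nat.choose_one_right, add_comm]
  rw [Finset.card_insert_of_notMem h, Finset.prod_insert h, hc, pow_add]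
  have hs : (-1 : ℂ) ^ v.card = sgn k v * sgn (-k) (refl v) := by
    rw [hcard, pow_add]; rfl
  rw [hs]
  linear_combination ((-1 : ℂ) ^ (v.card.choose 2) * ε k * (∏ j ∈ v, ε j) * sgn (-k) (refl v)) *
    sgn_mul_self k v

/-- The linear map `ket v ↦ theta v • ket (-v)`. -/
def rot (ε : ℤ → ℂ) (hε : ∀ k, ε k ≠ 0) : Fock ≃ₗ[ℂ] Fock :=
  LinearEquiv.ofLinearMap
    (Finsupp.linearCombination ℂ fun v => theta ε v • ket (refl v))
    (Finsupp.linearCombination ℂ fun v => (theta ε (refl v))⁻¹ • ket (refl v))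
    (end_ext fun v => by
      simp [ket, refl_refl, theta_ne_zero hε])
    (end_ext fun v => by
      simp [ket, refl_refl, theta_ne_zero hε])

section Rotation

variable {ε : ℤ → ℂ} (hε : ∀ k, ε k ≠ 0)

theorem rot_ket (v : Finset ℤ) : rot ε hε (ket v) = theta ε v • ket (refl v) := by
  simp [rot, ket]

theorem rot_symm_ket (v : Finset ℤ) :
    (rot ε hε).symm (ket v) = (theta ε (refl v))⁻¹ • ket (refl v) := by
  simp [rot, ket]

theorem rot_vac : rot ε hε vac = vac := by
  rw [vac, rot_ket, theta_empty, one_smul]; rfl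

theorem rot_apply (x : Fock) (v : Finset ℤ) : rot ε hε x v = theta ε (refl v) * x (refl v) := by
  induction x using Finsupp.induction_linear with
  | zero => simp
  | add x y hx hy => simp only [map_add, Finsupp.add_apply, hx, hy, mul_add]
  | single w z =>
    have : Finsupp.single w z = z • ket w := by simp [ket]
    rw [this, map_smul, rot_ket]
    simp only [Finsupp.smul_apply, smul_eq_mul, ket_apply]
    by_cases h : w = refl v
    · subst h; simp [refl_refl]; ring
    · have h' : refl w ≠ v := fun h' => h (by rw [← h', refl_refl])
      simp [h, h']

/-- Conjugation by the rotation. -/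
def conj : Module.End ℂ Fock ≃ₐ[ℂ] Module.End ℂ Fock := (rot ε hε).conjAlgEquiv ℂ

theorem conj_apply (A : Module.End ℂ Fock) (x : Fock) :
    conj hε A x = rot ε hε (A ((rot ε hε).symm x)) := rfl

theorem conj_rot (A : Module.End ℂ Fock) (x : Fock) :
    conj hε A (rot ε hε x) = rot ε hε (A x) := by
  rw [conj_apply, LinearEquiv.symm_apply_apply]

theorem conj_vac (A : Module.End ℂ Fock) : conj hε A vac = rot ε hε (A vac) := by
  conv_lhs => rw [← rot_vac hε]
  exact conj_rot hε A vac

theorem conj_eq_of_rot {A B : Module.End ℂ Fock}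
    (h : ∀ v, rot ε hε (A (ket v)) = B (rot ε hε (ket v))) : conj hε A = B := by
  refine end_ext fun v => ?_
  obtain ⟨v, rfl⟩ := refl.surjective v
  have h1 : ket (refl v) = (theta ε v)⁻¹ • rot ε hε (ket v) := by
    rw [rot_ket, smul_smul, inv_mul_cancel₀ (theta_ne_zero hε v), one_smul]
  rw [h1, map_smul, map_smul, conj_rot, h]

/-- `theta` is built for this: conjugation absorbs the change of fermionic sign and leaves only the
phase `ε k` on creation and its inverse on annihilation. -/
theorem conj_toggleOp (k : ℤ) (p q : ℂ) :
    conj hε (toggleOp k p q) = toggleOp (-k) ((ε k)⁻¹ * p) (ε k * q) := by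
  refine conj_eq_of_rot hε fun v => ?_
  rw [toggleOp_ket, map_smul, rot_ket, rot_ket, map_smul, toggleOp_ket, smul_smul, smul_smul,
    refl_symmDiff]
  congr 1
  have hm : -k ∈ refl v ↔ k ∈ v := by rw [mem_refl, neg_neg]
  simp only [hm]
  have hk := hε k
  by_cases h : k ∈ v
  · rw [if_pos h, if_pos h, toggle_of_mem h]
    have h1 := theta_insert ε (Finset.notMem_erase k v)
    rw [Finset.insert_erase h, ← toggle_of_mem h, sgn_toggle, refl_symmDiff, sgn_toggle,
      toggle_of_mem h] at h1
    simp only [lt_irrefl, if_false, one_mul] at h1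
    have h2 := sgn_mul_self k v
    have h3 := sgn_mul_self (-k) (refl v)
    field_simp
    have h4 : sgn k v * theta ε (v.erase k) * ε k =
        theta ε v * sgn (-k) (refl v) := by
      linear_combination (-sgn k v * theta ε (v.erase k) * ε k) * h3
        - sgn (-k) (refl v) * sgn k v * h1 + theta ε v * sgn (-k) (refl v) * h2
    linear_combination p * h4
  · rw [if_neg h, if_neg h, toggle_of_notMem h]
    linear_combination q * theta_insert ε h

theorem vacBra_conj (A : Module.End ℂ Fock) : vacBra (conj hε A vac) = vacBra (A vac) := by
  rw [conj_vac]
  change rot ε hε (A vac) ∅ = A vac ∅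
  rw [rot_apply]
  change theta ε ∅ * (A vac) ∅ = _
  rw [theta_empty, one_mul]

theorem conj_nord (A B : Module.End ℂ Fock) :
    conj hε (nord A B) = nord (conj hε A) (conj hε B) := by
  unfold nord
  rw [← map_mul, vacBra_conj]
  refine end_ext fun v => ?_
  simp [conj_apply, map_sub]

end Rotation

/-- The hat automorphism. -/
abbrev hatOp : Module.End ℂ Fock ≃ₐ[ℂ] Module.End ℂ Fock := conj phase_ne_zero

theorem hatOp_b (n : ℤ) : hatOp (b n) = bHat n := by
  have : phase |n| = phase n := by simp [phase]
  rw [b_eq, hatOp, conj_toggleOp, this, bHat_eq]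

theorem phase_inv_ne_zero (n : ℤ) : phase⁻¹ n ≠ 0 := inv_ne_zero (phase_ne_zero n)

/-- The inverse phases enter because transposing the rotation inverts them. They agree with the hat
up to the factor `phase n * phase n`, which is `-1` at `n = 0`. -/
theorem conj_inv_b (n : ℤ) : ∃ z : ℂ, conj phase_inv_ne_zero (b n) = z • bHat n := by
  refine ⟨phase n * phase n, ?_⟩
  have : phase |n| = phase n := by simp [phase]
  rw [b_eq, conj_toggleOp, bHat_eq, toggleOp_smul, Pi.inv_apply, this]
  have h0 := phase_ne_zero n
  have hp' : (phase n * phase n) * (phase n * phase n) = 1 := by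
    unfold phase; split_ifs <;> simp
  congr 1
  · field_simp
  · rw [inv_mul_eq_iff_eq_mul₀ h0]
    linear_combination -bCre n * hp'

/-- The matrix of the image of `h` under the hat automorphism. -/
def hatFormal (h : FormalOp) : FormalOp := fun v w =>
  theta phase (refl v) * (theta phase (refl w))⁻¹ * h (refl v) (refl w)

theorem toFormal_hatOp (A : Module.End ℂ Fock) : toFormal (hatOp A) = hatFormal (toFormal A) := by
  ext v w
  unfold toFormal hatFormal hatOp
  rw [conj_apply, rot_symm_ket, map_smul, rot_apply, Finsupp.smul_apply, smul_eq_mul]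
  ring

theorem IsProd.hatFormal {A B E : FormalOp} (h : IsProd A B E) :
    IsProd (hatFormal A) (hatFormal B) (hatFormal E) := by
  intro v w
  have h1 := (h (refl v) (refl w)).mul_left (theta phase (refl v) * (theta phase (refl w))⁻¹)
  rw [← refl.hasSum_iff] at h1
  have h2 : (fun u => BKP.hatFormal A v u * BKP.hatFormal B u w) =
      (fun u => theta phase (refl v) * (theta phase (refl w))⁻¹ *
        (A (refl v) u * B u (refl w))) ∘ refl := by
    funext u
    have := theta_ne_zero phase_ne_zero (refl u)
    simp only [BKP.hatFormal, Function.comp_apply]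
    field_simp
  rw [h2]
  exact h1

/-- The rotation fixes the vacuum expectation, so it respects normal ordering and carries the
generator term by term. -/
theorem quadratic_bHat (c : ℂ) (a : ℤ → ℤ → ℂ) :
    quadratic bHat c a = hatFormal (quadratic b c a) := by
  have h1 : toFormal 1 = hatFormal (toFormal 1) := by rw [← toFormal_hatOp, map_one]
  have h2 : ∀ i j, toFormal (nord (bHat i) (bHat j)) = hatFormal (toFormal (nord (b i) (b j))) := by
    intro i j
    rw [← toFormal_hatOp, conj_nord, hatOp_b, hatOp_b]
  ext v w
  unfold quadratic
  simp only [h2]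
  rw [congrFun (congrFun h1 v) w]
  unfold hatFormal
  rw [mul_add]
  congr 1
  · ring
  · rw [← smul_eq_mul (_ * _) (finsum _), smul_finsum]
    exact finsum_congr fun p => by rw [smul_eq_mul]; ring

theorem IsExp.hatFormal {Z E : FormalOp} (h : IsExp Z E) :
    IsExp (hatFormal Z) (hatFormal E) := by
  obtain ⟨P, h0, hs, hE⟩ := h
  refine ⟨fun k => BKP.hatFormal (P k), ?_, fun k => (hs k).hatFormal, fun v w => ?_⟩
  · simp only [h0]; rw [← toFormal_hatOp, map_one]
  · have h1 := (hE (refl v) (refl w)).mul_left (theta phase (refl v) * (theta phase (refl w))⁻¹)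
    simp only [← mul_div_assoc] at h1
    exact h1

theorem Value.hatFormal {x : GroupExpr} {h : FormalOp} (hx : Value b x h) :
    Value bHat x (hatFormal h) := by
  induction hx with
  | exp c a h hh => exact .exp c a _ (by rw [quadratic_bHat]; exact hh.hatFormal)
  | mul x y h₁ h₂ h _ _ hh ih₁ ih₂ => exact .mul x y _ _ _ ih₁ ih₂ hh.hatFormal
  | lim x H h _ hh ih => exact .lim x _ _ ih fun v w => (hh _ _).const_mul _


/-! ## Matrix elements as a bilinear form -/

/-- The bilinear form with matrix `h`. -/
def form (h : FormalOp) : Fock →ₗ[ℂ] Fock →ₗ[ℂ] ℂ :=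
  Finsupp.linearCombination ℂ fun v => Finsupp.linearCombination ℂ fun w => h v w

theorem form_ket (h : FormalOp) (v w : Finset ℤ) : form h (ket v) (ket w) = h v w := by
  simp [form, ket]

theorem form_ext {B C : Fock →ₗ[ℂ] Fock →ₗ[ℂ] ℂ}
    (h : ∀ v w, B (ket v) (ket w) = C (ket v) (ket w)) : B = C :=
  Finsupp.lhom_ext' fun v => LinearMap.ext_ring <|
    Finsupp.lhom_ext' fun w => LinearMap.ext_ring (h v w)

theorem form_eq_sum (h : FormalOp) (y x : Fock) :
    form h y x = y.sum fun v z => z * x.sum fun w c => h v w * c := by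
  unfold form
  rw [Finsupp.linearCombination_apply, Finsupp.sum, LinearMap.sum_apply, Finsupp.sum]
  refine Finset.sum_congr rfl fun v _ => ?_
  rw [LinearMap.smul_apply, Finsupp.linearCombination_apply, smul_eq_mul]
  congr 1
  exact Finsupp.sum_congr fun w _ => by rw [smul_eq_mul, mul_comm]

/-- A transpose `A'` makes the left vector a genuine finite combination of basis vectors, so the sum
in `pairing` is finite and bilinearity becomes available. -/
theorem pairing_eq_form {A A' : Module.End ℂ Fock} (hA : IsTranspose A A') (h : FormalOp)
    (x : Fock) : pairing (vacBra ∘ₗ A) h x = form h (A' vac) x := by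
  rw [form_eq_sum]
  unfold pairing
  have h1 : ∀ v, (vacBra ∘ₗ A) (ket v) = (A' vac) v := fun v => hA ∅ v
  simp only [h1]
  rw [finsum_eq_sum_of_support_subset _ (s := (A' vac).support)]
  · rfl
  · intro v hv
    simp only [Function.mem_support] at hv
    simpa using left_ne_zero_of_mul hv

/-- Since `hatFormal h` is `h` conjugated by the rotation, the right vector rotates with `phase` and
the left, dual vector with `phase⁻¹`; the weights then cancel. -/
theorem form_hatFormal (h : FormalOp) (x y : Fock) :
    form (hatFormal h) (rot _ phase_inv_ne_zero x) (rot _ phase_ne_zero y) = form h x y := by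
  have : (form (hatFormal h)).compl₁₂ (rot _ phase_inv_ne_zero).toLinearMap
      (rot _ phase_ne_zero).toLinearMap = form h := by
    refine form_ext fun v w => ?_
    simp only [LinearMap.compl₁₂_apply, LinearEquiv.coe_coe, rot_ket, map_smul,
      LinearMap.smul_apply, form_ket, smul_eq_mul, hatFormal, refl_refl, theta_inv]
    have h1 := theta_ne_zero phase_ne_zero v
    have h2 := theta_ne_zero phase_ne_zero w
    field_simp
  exact congrArg (fun B => B x y) this

theorem conj_isTranspose {A A' : Module.End ℂ Fock} (h : IsTranspose A A') :
    IsTranspose (hatOp A) (conj phase_inv_ne_zero A') := by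
  intro v w
  rw [hatOp, conj_apply, conj_apply, rot_symm_ket, rot_symm_ket, map_smul, map_smul, map_smul,
    map_smul, Finsupp.smul_apply, Finsupp.smul_apply, rot_apply, rot_apply, h (refl v) (refl w), theta_inv, theta_inv,
    inv_inv, smul_eq_mul, smul_eq_mul]
  ring

theorem form_commMono {h : FormalOp} {D : Finset ℤ} {c : Finset ℤ → ℂ} (hc : CommMono h D c)
    {A : Module.End ℂ Fock} (hA : IsTranspose (mono D c) A) (x y : Fock) :
    form h (A x) y = form h x (mono D c y) := by
  have : (form h).compl₁₂ A LinearMap.id = (form h).compl₁₂ LinearMap.id (mono D c) := by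
    refine form_ext fun v w => ?_
    rw [← (mono_isTranspose D c).eq hA]
    simp only [LinearMap.compl₁₂_apply, LinearMap.id_apply, mono_ket, map_smul,
      LinearMap.smul_apply, form_ket, smul_eq_mul, hc v w]
  exact congrArg (fun B => B x y) this

/-! ## Even products of fermions -/

/-- Multiples of products of two fermions. -/
def quadGens (e : ℤ → Module.End ℂ Fock) : Set (Module.End ℂ Fock) :=
  {A | ∃ (z : ℂ) (i j : ℤ), A = z • (e i * e j)}

/-- Multiples of products of evenly many fermions. -/
abbrev words (e : ℤ → Module.End ℂ Fock) : Submonoid (Module.End ℂ Fock) :=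
  Submonoid.closure (quadGens e)

theorem mul_mem_words (e : ℤ → Module.End ℂ Fock) (i j : ℤ) : e i * e j ∈ words e :=
  Submonoid.subset_closure ⟨1, i, j, (one_smul _ _).symm⟩

/-- The properties of the families `b` and `bHat` used for their products. -/
structure IsFermion (e : ℤ → Module.End ℂ Fock) : Prop where
  toggle : ∀ i, ∃ k p q, e i = toggleOp k p q
  transpose : ∀ i, ∃ z : ℂ, IsTranspose (e i) (z • e (-i))

theorem isFermion_b : IsFermion b :=
  ⟨fun i => ⟨_, _, _, b_eq i⟩, fun i => ⟨_, b_isTranspose i⟩⟩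

theorem isFermion_bHat : IsFermion bHat :=
  ⟨fun i => ⟨_, _, _, bHat_eq i⟩, bHat_isTranspose⟩

theorem IsFermion.exists_mono {e : ℤ → Module.End ℂ Fock} (he : IsFermion e)
    {A : Module.End ℂ Fock} (hA : A ∈ words e) : ∃ D c, A = mono D c := by
  induction hA using Submonoid.closure_induction with
  | mem A hA =>
    obtain ⟨z, i, j, rfl⟩ := hA
    obtain ⟨k, p, q, h1⟩ := he.toggle i
    obtain ⟨k', p', q', h2⟩ := he.toggle j
    rw [h1, h2, toggleOp, toggleOp, mono_mul, mono_smul]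
    exact ⟨_, _, rfl⟩
  | one => exact ⟨_, _, mono_one.symm⟩
  | mul A B _ _ hA hB =>
    obtain ⟨D, c, rfl⟩ := hA
    obtain ⟨D', c', rfl⟩ := hB
    exact ⟨_, _, mono_mul _ _ _ _⟩

theorem IsFermion.exists_transpose {e : ℤ → Module.End ℂ Fock} (he : IsFermion e)
    {A : Module.End ℂ Fock} (hA : A ∈ words e) : ∃ A' ∈ words e, IsTranspose A A' := by
  induction hA using Submonoid.closure_induction with
  | mem A hA =>
    obtain ⟨z, i, j, rfl⟩ := hA
    obtain ⟨p, h1⟩ := he.transpose i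
    obtain ⟨q, h2⟩ := he.transpose j
    refine ⟨_, Submonoid.subset_closure ⟨z * (q * p), -j, -i, rfl⟩, ?_⟩
    convert (h1.mul h2).smul z using 1
    rw [smul_mul_smul_comm, smul_smul]
  | one => exact ⟨1, one_mem _, IsTranspose.one⟩
  | mul A B _ _ hA hB =>
    obtain ⟨A', hA', h1⟩ := hA
    obtain ⟨B', hB', h2⟩ := hB
    exact ⟨B' * A', mul_mem hB' hA', h1.mul h2⟩

theorem commute_of_mem_words {e : ℤ → Module.End ℂ Fock} {M : Module.End ℂ Fock}
    (hM : ∀ i j, Commute M (e i * e j)) {A : Module.End ℂ Fock} (hA : A ∈ words e) :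
    Commute M A := by
  induction hA using Submonoid.closure_induction with
  | mem A hA =>
    obtain ⟨z, i, j, rfl⟩ := hA
    exact (hM i j).smul_right z
  | one => exact Commute.one_right _
  | mul A B _ _ hA hB => exact hA.mul_right hB

theorem Anticomm.commute_mul {R : Type*} [Ring R] {x y z : R} (h : Anticomm x z)
    (h' : Anticomm y z) : Commute (x * y) z := by
  have h1 : x * z = -(z * x) := eq_neg_of_add_eq_zero_left h
  have h2 : y * z = -(z * y) := eq_neg_of_add_eq_zero_left h'
  change x * y * z = z * (x * y)
  rw [mul_assoc, h2, mul_neg, ← mul_assoc, h1, neg_mul, neg_neg, mul_assoc]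

theorem words_commute {A B : Module.End ℂ Fock} (hA : A ∈ words b) (hB : B ∈ words bHat) :
    Commute A B := by
  refine commute_of_mem_words (fun i j => (commute_of_mem_words (fun k l => ?_) hA).symm) hB
  have h : ∀ m, Commute (b k * b l) (bHat m) := fun m =>
    (b_bHat_anticomm k m).commute_mul (b_bHat_anticomm l m)
  exact ((h i).mul_right (h j)).symm

/-! ### Conserved quantities: occupation numbers and fermion parity -/

theorem diag_commute {d : Finset ℤ → ℂ} {j k : ℤ} (h : ∀ v, d (symmDiff (symmDiff v {j}) {k}) = d v)
    (p q p' q' : ℂ) : Commute (mono ∅ d) (toggleOp j p q * toggleOp k p' q') := by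
  unfold toggleOp Commute SemiconjBy
  rw [mono_mul, mono_mul, mono_mul, ← Finset.bot_eq_empty, bot_symmDiff, symmDiff_bot]
  congr 1; ext v
  rw [symmDiff_bot, ← symmDiff_assoc, h, mul_comm]

/-- The indicator function of the occupied mode `k`. -/
def occupied (k : ℤ) (v : Finset ℤ) : ℂ := if k ∈ v then 1 else 0

theorem occupied_toggle {j k : ℤ} (h : j ≠ k) (v : Finset ℤ) :
    occupied k (symmDiff v {j}) = occupied k v := by
  unfold occupied
  have : k ∈ symmDiff v {j} ↔ k ∈ v := by rw [mem_toggle]; have := h.symm; tauto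
  simp [this]

/-- The fermion parity. -/
def parity (v : Finset ℤ) : ℂ := (-1) ^ v.card

theorem parity_toggle (k : ℤ) (v : Finset ℤ) : parity (symmDiff v {k}) = -parity v := by
  unfold parity
  by_cases h : k ∈ v
  · rw [toggle_of_mem h]
    conv_rhs => rw [← Finset.insert_erase h, Finset.card_insert_of_notMem (Finset.notMem_erase k v)]
    rw [pow_succ]; ring
  · rw [toggle_of_notMem h, Finset.card_insert_of_notMem h, pow_succ]; ring

theorem occupied_commute_b {k : ℤ} (hk : k < 0) (i j : ℤ) :
    Commute (mono ∅ (occupied k)) (b i * b j) := by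
  rw [b_eq, b_eq]
  have h1 := abs_nonneg i
  have h2 := abs_nonneg j
  refine diag_commute (fun v => ?_) _ _ _ _
  rw [occupied_toggle (by omega), occupied_toggle (by omega)]

theorem occupied_commute_bHat {k : ℤ} (hk : 0 < k) (i j : ℤ) :
    Commute (mono ∅ (occupied k)) (bHat i * bHat j) := by
  rw [bHat_eq, bHat_eq]
  have h1 := abs_nonneg i
  have h2 := abs_nonneg j
  refine diag_commute (fun v => ?_) _ _ _ _
  rw [occupied_toggle (by omega), occupied_toggle (by omega)]

theorem parity_commute_b (i j : ℤ) : Commute (mono ∅ parity) (b i * b j) := by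
  rw [b_eq, b_eq]
  exact diag_commute (fun v => by rw [parity_toggle, parity_toggle, neg_neg]) _ _ _ _

/-- A selection rule: commuting with a diagonal operator forbids matrix elements between different
eigenvalues. -/
theorem CommMono.eq_of_ne_zero {h : FormalOp} {d : Finset ℤ → ℂ} (hd : CommMono h ∅ d)
    {v w : Finset ℤ} (hvw : h v w ≠ 0) : d v = d w := by
  have h1 := hd v w
  rw [← Finset.bot_eq_empty, symmDiff_bot, symmDiff_bot] at h1
  exact (mul_right_cancel₀ hvw h1).symm

theorem form_eq_zero_of_diag {h : FormalOp} {d : Finset ℤ → ℂ} (hd : CommMono h ∅ d)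
    {A B : Module.End ℂ Fock} (hA : Commute (mono ∅ d) A) (hB : Commute (mono ∅ d) B)
    {v w : Finset ℤ} (hvw : d v ≠ d w) : form h (A (ket v)) (B (ket w)) = 0 := by
  have ht : IsTranspose (mono ∅ d) (mono ∅ d) := by
    have := mono_isTranspose ∅ d
    simpa only [← Finset.bot_eq_empty, symmDiff_bot] using this
  have hket : ∀ u, mono ∅ d (ket u) = d u • ket u := fun u => by
    rw [mono_ket, ← Finset.bot_eq_empty, symmDiff_bot]
  have h1 := form_commMono hd ht (A (ket v)) (B (ket w))
  have hA' : mono ∅ d (A (ket v)) = d v • A (ket v) := by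
    rw [← Module.End.mul_apply, hA.eq, Module.End.mul_apply, hket, map_smul]
  have hB' : mono ∅ d (B (ket w)) = d w • B (ket w) := by
    rw [← Module.End.mul_apply, hB.eq, Module.End.mul_apply, hket, map_smul]
  rw [hA', hB', map_smul, map_smul, LinearMap.smul_apply, smul_eq_mul, smul_eq_mul] at h1
  by_contra h2
  exact hvw (mul_right_cancel₀ h2 h1)

/-! ## The product of `h` and its hat -/

/-- The product of two formal operators, where it converges by finiteness. -/
def prodFormal (A B : FormalOp) : FormalOp := fun v w => ∑ᶠ u, A v u * B u w

theorem isProd_prodFormal {x x' : GroupExpr} {h k : FormalOp} (hx : Value b x h)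
    (hx' : Value bHat x' k) : IsProd h k (prodFormal h k) := by
  intro v w
  -- A contributing `u` has the negative modes of `v`, untouched by `h`, and the positive modes of
  -- `w`, untouched by `k`. Only the shared mode `0` is free, so there are finitely many such `u`.
  have hs : (Function.support fun u => h v u * k u w) ⊆ ((v ∪ w ∪ {0}).powerset : Finset _) := by
    intro u hu
    simp only [Function.mem_support] at hu
    have h1 := left_ne_zero_of_mul hu
    have h2 := right_ne_zero_of_mul hu
    rw [Finset.mem_coe, Finset.mem_powerset]
    intro j hj
    simp only [Finset.mem_union, Finset.mem_singleton]
    rcases lt_trichotomy j 0 with h' | h' | h'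
    · have := (hx.commMono (occupied_commute_b h')).eq_of_ne_zero h1
      unfold occupied at this
      rw [if_pos hj] at this
      by_contra hv
      rw [if_neg (by tauto)] at this
      exact zero_ne_one this
    · exact Or.inr h'
    · have := (hx'.commMono (occupied_commute_bHat h')).eq_of_ne_zero h2
      unfold occupied at this
      rw [if_pos hj] at this
      by_contra hv
      rw [if_neg (by tauto)] at this
      exact one_ne_zero this
  rw [prodFormal, finsum_eq_sum_of_support_subset _ hs]
  exact hasSum_sum_of_ne_finset_zero fun u hu => by
    by_contra h'
    exact hu (Finset.mem_coe.1 (hs h'))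

theorem form_prodFormal (A B : FormalOp) (y z : ℂ) (v w : Finset ℤ) :
    form (prodFormal A B) (y • ket v) (z • ket w) =
      ∑ᶠ u, form A (y • ket v) (ket u) * form B (ket u) (z • ket w) := by
  simp only [map_smul, LinearMap.smul_apply, form_ket, smul_eq_mul, prodFormal]
  rw [← smul_eq_mul z, ← smul_eq_mul y, smul_finsum, smul_finsum]
  exact finsum_congr fun u => by simp only [smul_eq_mul]; ring

/-- A monomial operator permutes basis vectors up to scalars, so it can be moved across a sum over
all states by reindexing, without finiteness assumptions. -/
theorem finsum_shift {M M' : Module.End ℂ Fock} {D : Finset ℤ} {c : Finset ℤ → ℂ}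
    (hM : M = mono D c) (ht : IsTranspose M M') (p q : Fock → ℂ)
    (hp : ∀ (z : ℂ) x, p (z • x) = z * p x) (hq : ∀ (z : ℂ) x, q (z • x) = z * q x) :
    ∑ᶠ u, p (M (ket u)) * q (ket u) = ∑ᶠ u, p (ket u) * q (M' (ket u)) := by
  subst hM
  rw [← (mono_isTranspose D c).eq ht]
  rw [← finsum_comp_equiv (toggleEquiv D)]
  refine finsum_congr fun u => ?_
  simp only [toggleEquiv, Equiv.coe_fn_mk, mono_ket, symmDiff_symmDiff_cancel_right, hp, hq]
  ring

/-- Carries the factorization. Commuting `X₂` through `h` and `Y₁` through `k` and shifting both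
across the intermediate states pairs `h` with the `b`-words alone and `k` with the `bHat`-words
alone, joined by a sum over `u` in which only `u = ∅` contributes. -/
theorem form_prodFormal_words {x x' : GroupExpr} {h k : FormalOp} (hx : Value b x h)
    (hx' : Value bHat x' k) {X₁ X₂ Y₁ Y₂ : Module.End ℂ Fock} (hX₁ : X₁ ∈ words b)
    (hX₂ : X₂ ∈ words bHat) (hY₁ : Y₁ ∈ words b) (hY₂ : Y₂ ∈ words bHat) :
    form (prodFormal h k) (X₂ (X₁ vac)) (Y₁ (Y₂ vac)) =
      form h (X₁ vac) (Y₁ vac) * form k (X₂ vac) (Y₂ vac) := by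
  obtain ⟨X, hX, hXt⟩ := isFermion_bHat.exists_transpose hX₂
  obtain ⟨Y, hY, hYt⟩ := isFermion_b.exists_transpose hY₁
  obtain ⟨D, c, hXm⟩ := isFermion_bHat.exists_mono hX
  obtain ⟨E, d, hYm⟩ := isFermion_b.exists_mono hY₁
  obtain ⟨E', d', hYm'⟩ := isFermion_b.exists_mono hY
  have hket : ∀ {e e' : ℤ → Module.End ℂ Fock} (_ : IsFermion e) (_ : IsFermion e')
      {A B : Module.End ℂ Fock}, A ∈ words e → B ∈ words e' → ∃ (z : ℂ) (v : Finset ℤ),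
        A (B vac) = z • ket v := by
    intro e e' he he' A B hA hB
    obtain ⟨D, c, rfl⟩ := he.exists_mono hA
    obtain ⟨D', c', rfl⟩ := he'.exists_mono hB
    exact ⟨_, _, by rw [vac, mono_ket, map_smul, mono_ket, smul_smul]⟩
  -- On the left `X₂` acts on the dual vector, so it emerges on the other side of `h` as its
  -- transpose `X`.
  have hleft : ∀ u, form h (X₂ (X₁ vac)) (ket u) = form h (X₁ vac) (X (ket u)) := by
    intro u
    rw [hXm]
    refine form_commMono (hx.commMono fun i j => ?_) (hXm ▸ hXt.symm) _ _
    rw [← hXm]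
    exact (words_commute (mul_mem_words b i j) hX).symm
  have hright : ∀ u, form k (ket u) (Y₁ (Y₂ vac)) = form k (Y (ket u)) (Y₂ vac) := by
    intro u
    rw [hYm]
    refine (form_commMono (hx'.commMono fun i j => ?_) (hYm ▸ hYt) _ _).symm
    rw [← hYm]
    exact words_commute hY₁ (mul_mem_words bHat i j)
  obtain ⟨y, v, h1⟩ := hket isFermion_bHat isFermion_b hX₂ hX₁
  obtain ⟨z, w, h2⟩ := hket isFermion_b isFermion_bHat hY₁ hY₂
  have h3 := form_prodFormal h k y z v w
  rw [← h1, ← h2] at h3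
  rw [h3]
  simp only [hleft, hright]
  rw [finsum_shift hXm hXt.symm (fun s => form h (X₁ vac) s)
    (fun s => form k (Y s) (Y₂ vac)) (by simp) (by simp)]
  have hcomm : ∀ u, Y (X₂ (ket u)) = X₂ (Y (ket u)) := fun u =>
    congrArg (fun A : Module.End ℂ Fock => A (ket u)) (words_commute hY hX₂).eq
  simp only [hcomm]
  have h4 := finsum_shift hYm' hYt.symm (fun s => form k (X₂ s) (Y₂ vac))
    (fun s => form h (X₁ vac) s) (by simp) (by simp)
  have h5 : ∀ u, form h (X₁ vac) (ket u) * form k (X₂ (Y (ket u))) (Y₂ vac) =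
      form k (X₂ (Y (ket u))) (Y₂ vac) * form h (X₁ vac) (ket u) := fun u => mul_comm _ _
  simp only [h5]
  rw [h4]
  rw [finsum_eq_single _ ∅]
  · rw [mul_comm]; rfl
  · intro u hu
    have hpar : ∀ {A}, A ∈ words b → Commute (mono ∅ parity) A :=
      fun hA => commute_of_mem_words parity_commute_b hA
    by_cases hneg : ∃ j ∈ u, j < 0
    · obtain ⟨j, hj, hj0⟩ := hneg
      have hc := occupied_commute_b hj0
      refine mul_eq_zero_of_right _ (form_eq_zero_of_diag (hx.commMono hc)
        (commute_of_mem_words hc hX₁) (commute_of_mem_words hc hY₁) ?_)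
      simp [occupied, hj]
    by_cases hpos : ∃ j ∈ u, 0 < j
    · obtain ⟨j, hj, hj0⟩ := hpos
      have hc := occupied_commute_bHat hj0
      refine mul_eq_zero_of_left (form_eq_zero_of_diag (hx'.commMono hc)
        (commute_of_mem_words hc hX₂) (commute_of_mem_words hc hY₂) ?_) _
      simp [occupied, hj]
    -- Both `b 0` and `bHat 0` toggle the mode `0`, so its occupation is not conserved; `u = {0}` is
    -- excluded because it is odd while all words are even.
    · have hu0 : u = {0} := by
        refine Finset.eq_singleton_iff_nonempty_unique_mem.2
          ⟨Finset.nonempty_iff_ne_empty.2 hu, fun j hj => ?_⟩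
        rcases lt_trichotomy j 0 with h' | h' | h'
        · exact absurd ⟨j, hj, h'⟩ hneg
        · exact h'
        · exact absurd ⟨j, hj, h'⟩ hpos
      refine mul_eq_zero_of_right _ (form_eq_zero_of_diag (hx.commMono parity_commute_b)
        (hpar hX₁) (hpar hY₁) ?_)
      rw [hu0]
      norm_num [parity]

/-! ## Locally finite even operators -/

/-- The algebra of even polynomials in the fermions `e`. -/
abbrev evenAlg (e : ℤ → Module.End ℂ Fock) : Subalgebra ℂ (Module.End ℂ Fock) :=
  Algebra.adjoin ℂ (quadGens e)

/-- The closure of the algebra of even polynomials in the topology of pointwise convergence. -/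
def localAlg (e : ℤ → Module.End ℂ Fock) : Subalgebra ℂ (Module.End ℂ Fock) where
  carrier := {A | ∀ F : Finset Fock, ∃ A' ∈ evenAlg e, ∀ y ∈ F, A y = A' y}
  mul_mem' := by
    classical
    intro A B hA hB F
    obtain ⟨B', hB', h1⟩ := hB F
    obtain ⟨A', hA', h2⟩ := hA (F.image B')
    refine ⟨A' * B', mul_mem hA' hB', fun y hy => ?_⟩
    rw [Module.End.mul_apply, Module.End.mul_apply, h1 y hy, h2 _ (Finset.mem_image_of_mem _ hy)]
  add_mem' := by
    intro A B hA hB F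
    obtain ⟨B', hB', h1⟩ := hB F
    obtain ⟨A', hA', h2⟩ := hA F
    exact ⟨A' + B', add_mem hA' hB', fun y hy => by simp [h1 y hy, h2 y hy]⟩
  algebraMap_mem' z F := ⟨_, Subalgebra.algebraMap_mem _ z, fun _ _ => rfl⟩

theorem evenAlg_le_localAlg (e : ℤ → Module.End ℂ Fock) : evenAlg e ≤ localAlg e :=
  fun A hA _ => ⟨A, hA, fun _ _ => rfl⟩

theorem mul_mem_evenAlg (e : ℤ → Module.End ℂ Fock) (i j : ℤ) : e i * e j ∈ evenAlg e :=
  Algebra.subset_adjoin ⟨1, i, j, (one_smul _ _).symm⟩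

theorem evenAlg_induction {e : ℤ → Module.End ℂ Fock} {p : Module.End ℂ Fock → Prop}
    (word : ∀ A ∈ words e, p A) (zero : p 0) (add : ∀ A B, p A → p B → p (A + B))
    (smul : ∀ (z : ℂ) A, p A → p (z • A)) {A : Module.End ℂ Fock} (hA : A ∈ evenAlg e) : p A := by
  rw [← Subalgebra.mem_toSubmodule, Algebra.adjoin_eq_span] at hA
  exact Submodule.span_induction word zero (fun A B _ _ => add A B) (fun z A _ => smul z A) hA

theorem localAlg_commute {A B : Module.End ℂ Fock} (hA : A ∈ localAlg b) (hB : B ∈ localAlg bHat) :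
    Commute A B := by
  classical
  have h : ∀ A' ∈ evenAlg b, ∀ B' ∈ evenAlg bHat, Commute A' B' := by
    intro A' hA' B' hB'
    refine evenAlg_induction (fun B' hB' => evenAlg_induction (fun A' hA' => words_commute hA' hB')
      (Commute.zero_left _) (fun _ _ => Commute.add_left) (fun z _ h => h.smul_left z) hA')
      (Commute.zero_right _) (fun _ _ => Commute.add_right) (fun z _ h => h.smul_right z) hB'
  refine LinearMap.ext fun y => ?_
  -- The approximant of `B` is chosen second, so that it can be exact on `A' y` as well.
  obtain ⟨A', hA', h1⟩ := hA {y, B y}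
  obtain ⟨B', hB', h2⟩ := hB {y, A' y}
  have h3 := congrArg (fun M : Module.End ℂ Fock => M y) (h A' hA' B' hB').eq
  simp only [Module.End.mul_apply] at h3 ⊢
  rw [h1 (B y) (by simp), h1 y (by simp), h2 y (by simp), h2 (A' y) (by simp), h3]

theorem conj_mem_localAlg {ε : ℤ → ℂ} (hε : ∀ k, ε k ≠ 0)
    (h : ∀ i, ∃ z : ℂ, conj hε (b i) = z • bHat i) {A : Module.End ℂ Fock} (hA : A ∈ localAlg b) :
    conj hε A ∈ localAlg bHat := by
  classical
  intro F
  obtain ⟨A', hA', h1⟩ := hA (F.image (rot ε hε).symm)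
  refine ⟨conj hε A', ?_, fun y hy => by
    rw [conj_apply, conj_apply, h1 _ (Finset.mem_image_of_mem _ hy)]⟩
  have h2 : evenAlg b ≤ (evenAlg bHat).comap (conj hε).toAlgHom := by
    refine Algebra.adjoin_le ?_
    rintro _ ⟨z, i, j, rfl⟩
    obtain ⟨p, hp⟩ := h i
    obtain ⟨q, hq⟩ := h j
    refine Algebra.subset_adjoin ⟨z * (p * q), i, j, ?_⟩
    change conj hε (z • (b i * b j)) = _
    rw [map_smul, map_mul, hp, hq, smul_mul_smul_comm, smul_smul]
  exact h2 hA'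

/-- Both sides are linear in each of the four operators, and even polynomials are spanned by words.
-/
theorem form_prodFormal_evenAlg {x x' : GroupExpr} {h k : FormalOp} (hx : Value b x h)
    (hx' : Value bHat x' k) {X₁ X₂ Y₁ Y₂ : Module.End ℂ Fock} (hX₁ : X₁ ∈ evenAlg b)
    (hX₂ : X₂ ∈ evenAlg bHat) (hY₁ : Y₁ ∈ evenAlg b) (hY₂ : Y₂ ∈ evenAlg bHat) :
    form (prodFormal h k) (X₂ (X₁ vac)) (Y₁ (Y₂ vac)) =
      form h (X₁ vac) (Y₁ vac) * form k (X₂ vac) (Y₂ vac) := by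
  refine evenAlg_induction (e := b) (p := fun X₁ => form (prodFormal h k) (X₂ (X₁ vac)) (Y₁ (Y₂ vac)) =
      form h (X₁ vac) (Y₁ vac) * form k (X₂ vac) (Y₂ vac)) (fun X₁ hX₁ => ?_) (by simp)
      (fun A B hA hB => by simp [hA, hB, add_mul]) (fun z A hA => by simp [hA, mul_assoc]) hX₁
  refine evenAlg_induction (e := bHat) (p := fun X₂ => form (prodFormal h k) (X₂ (X₁ vac)) (Y₁ (Y₂ vac)) =
      form h (X₁ vac) (Y₁ vac) * form k (X₂ vac) (Y₂ vac)) (fun X₂ hX₂ => ?_) (by simp)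
      (fun A B hA hB => by simp [hA, hB, mul_add]) (fun z A hA => by simp [hA, mul_left_comm]) hX₂
  refine evenAlg_induction (e := b) (p := fun Y₁ => form (prodFormal h k) (X₂ (X₁ vac)) (Y₁ (Y₂ vac)) =
      form h (X₁ vac) (Y₁ vac) * form k (X₂ vac) (Y₂ vac)) (fun Y₁ hY₁ => ?_) (by simp)
      (fun A B hA hB => by simp [hA, hB, add_mul]) (fun z A hA => by simp [hA, mul_assoc]) hY₁
  refine evenAlg_induction (e := bHat) (p := fun Y₂ => form (prodFormal h k) (X₂ (X₁ vac)) (Y₁ (Y₂ vac)) =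
      form h (X₁ vac) (Y₁ vac) * form k (X₂ vac) (Y₂ vac)) (fun Y₂ hY₂ => ?_) (by simp)
      (fun A B hA hB => by simp [hA, hB, mul_add]) (fun z A hA => by simp [hA, mul_left_comm]) hY₂
  exact form_prodFormal_words hx hx' hX₁ hX₂ hY₁ hY₂

theorem form_prodFormal_localAlg {x x' : GroupExpr} {h k : FormalOp} (hx : Value b x h)
    (hx' : Value bHat x' k) {X₁ X₂ Y₁ Y₂ : Module.End ℂ Fock} (hX₁ : X₁ ∈ localAlg b)
    (hX₂ : X₂ ∈ localAlg bHat) (hY₁ : Y₁ ∈ localAlg b) (hY₂ : Y₂ ∈ localAlg bHat) :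
    form (prodFormal h k) (X₂ (X₁ vac)) (Y₁ (Y₂ vac)) =
      form h (X₁ vac) (Y₁ vac) * form k (X₂ vac) (Y₂ vac) := by
  classical
  -- The inner operators are approximated first, so that the outer ones can be matched at the
  -- vectors these produce.
  obtain ⟨A₁, hA₁, h1⟩ := hX₁ {vac}
  obtain ⟨A₂, hA₂, h2⟩ := hX₂ {vac, A₁ vac}
  obtain ⟨B₂, hB₂, h3⟩ := hY₂ {vac}
  obtain ⟨B₁, hB₁, h4⟩ := hY₁ {vac, B₂ vac}
  rw [h1 vac (by simp), h2 (A₁ vac) (by simp), h2 vac (by simp), h3 vac (by simp),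
    h4 vac (by simp), h4 (B₂ vac) (by simp)]
  exact form_prodFormal_evenAlg hx hx' hA₁ hA₂ hB₁ hB₂

/-- The algebra of operators in `localAlg b` that have a transpose in it. -/
def rowFiniteAlg : Subalgebra ℂ (Module.End ℂ Fock) where
  carrier := {A | A ∈ localAlg b ∧ ∃ A' ∈ localAlg b, IsTranspose A A'}
  mul_mem' := by
    rintro A B ⟨hA, A', hA', h1⟩ ⟨hB, B', hB', h2⟩
    exact ⟨mul_mem hA hB, B' * A', mul_mem hB' hA', h1.mul h2⟩
  add_mem' := by
    rintro A B ⟨hA, A', hA', h1⟩ ⟨hB, B', hB', h2⟩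
    exact ⟨add_mem hA hB, A' + B', add_mem hA' hB', h1.add h2⟩
  algebraMap_mem' z := ⟨Subalgebra.algebraMap_mem _ z, _, Subalgebra.algebraMap_mem _ z, by
    rw [Algebra.algebraMap_eq_smul_one]; exact IsTranspose.one.smul z⟩

theorem evenAlg_le_rowFiniteAlg : evenAlg b ≤ rowFiniteAlg := by
  refine Algebra.adjoin_le ?_
  intro A hA
  obtain ⟨A', hA', h⟩ := isFermion_b.exists_transpose (Submonoid.subset_closure hA)
  have hw : words b ≤ (evenAlg b).toSubmonoid :=
    Submonoid.closure_le.2 Algebra.subset_adjoin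
  exact ⟨evenAlg_le_localAlg b (Algebra.subset_adjoin hA), A', evenAlg_le_localAlg b (hw hA'), h⟩

theorem hatOp_mem_localAlg {A : Module.End ℂ Fock} (hA : A ∈ localAlg b) :
    hatOp A ∈ localAlg bHat :=
  conj_mem_localAlg _ (fun i => ⟨1, by rw [one_smul]; exact hatOp_b i⟩) hA

/-- The vacuum expectation value of an operator times its hat factorizes. -/
theorem pairing_prodFormal {x : GroupExpr} {h : FormalOp} (hx : Value b x h)
    {A₁ A₂ B₁ B₂ : Module.End ℂ Fock} (hA₁ : A₁ ∈ rowFiniteAlg) (hA₂ : A₂ ∈ rowFiniteAlg)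
    (hB₁ : B₁ ∈ localAlg b) (hB₂ : B₂ ∈ localAlg b) :
    pairing (vacBra ∘ₗ (A₁ * hatOp A₂)) (prodFormal h (hatFormal h)) (B₁ (hatOp B₂ vac)) =
      pairing (vacBra ∘ₗ A₁) h (B₁ vac) * pairing (vacBra ∘ₗ A₂) h (B₂ vac) := by
  obtain ⟨_, A₁', hA₁', h1⟩ := hA₁
  obtain ⟨_, A₂', hA₂', h2⟩ := hA₂
  rw [pairing_eq_form (h1.mul (conj_isTranspose h2)), pairing_eq_form h1, pairing_eq_form h2,
    Module.End.mul_apply, form_prodFormal_localAlg hx hx.hatFormal hA₁'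
      (conj_mem_localAlg _ conj_inv_b hA₂') hB₁ (hatOp_mem_localAlg hB₂), conj_vac, hatOp,
    conj_vac, form_hatFormal]


/-! ## The two-component fermions in terms of the neutral ones -/

theorem Anticomm.symm {R : Type*} [Ring R] {x y : R} (h : Anticomm x y) : Anticomm y x := by
  unfold Anticomm at *; rw [add_comm]; exact h

theorem Anticomm.mul_eq {R : Type*} [Ring R] {x y : R} (h : Anticomm x y) : x * y = -(y * x) :=
  eq_neg_of_add_eq_zero_left h

theorem Anticomm.add_right {R : Type*} [Ring R] {x y z : R} (h : Anticomm x y)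
    (h' : Anticomm x z) : Anticomm x (y + z) := by
  unfold Anticomm at *
  rw [mul_add, add_mul, add_add_add_comm, h, h', add_zero]

theorem Anticomm.add_left {R : Type*} [Ring R] {x y z : R} (h : Anticomm x z)
    (h' : Anticomm y z) : Anticomm (x + y) z :=
  (h.symm.add_right h'.symm).symm

theorem Anticomm.smul_right {R : Type*} [Ring R] [Algebra ℂ R] {x y : R} (h : Anticomm x y)
    (z : ℂ) : Anticomm x (z • y) := by
  unfold Anticomm at *
  rw [mul_smul_comm, smul_mul_assoc, ← smul_add, h, smul_zero]

theorem Anticomm.smul_left {R : Type*} [Ring R] [Algebra ℂ R] {x y : R} (h : Anticomm x y)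
    (z : ℂ) : Anticomm (z • x) y := (h.symm.smul_right z).symm

theorem bHat_anticomm {m n : ℤ} (h : m + n ≠ 0) : Anticomm (bHat m) (bHat n) := by
  have h1 := congrArg hatOp (b_anticomm h)
  rw [map_add, map_mul, map_mul, map_zero, hatOp_b, hatOp_b] at h1
  exact h1

/-- The neutral mode of the fermion `psi j`. -/
def idx (j : ℤ) : ℤ := if 0 ≤ j then 2 * j + 1 else 2 * j

theorem neg_one_zpow_idx (j : ℤ) : (-1 : ℂ) ^ idx j = if 0 ≤ j then -1 else 1 := by
  unfold idx
  split_ifs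
  · exact Odd.neg_one_zpow ⟨j, rfl⟩
  · exact Even.neg_one_zpow ⟨j, two_mul j⟩

theorem idx_add_neg_ne_zero {i j : ℤ} (h : i ≠ j) : idx i + -idx j ≠ 0 := by
  unfold idx; split_ifs <;> omega

theorem idx_add_ne_zero (i j : ℤ) : idx i + idx j ≠ 0 := by
  unfold idx; split_ifs <;> omega

/-- The fermions `psi` made from the neutral fermions `e`. -/
def psiOf (e : ℤ → Module.End ℂ Fock) (j : ℤ) : Module.End ℂ Fock := e (idx j)

/-- The fermions `psiDag` made from the neutral fermions `e`. -/
def psiDagOf (e : ℤ → Module.End ℂ Fock) (j : ℤ) : Module.End ℂ Fock :=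
  (-1 : ℂ) ^ idx j • e (-idx j)

theorem hatOp_psiOf (j : ℤ) : hatOp (psiOf b j) = psiOf bHat j := hatOp_b _

theorem hatOp_psiDagOf (j : ℤ) : hatOp (psiDagOf b j) = psiDagOf bHat j := by
  unfold psiDagOf; rw [map_smul, hatOp_b]

theorem sqrtTwo_mul_self : sqrtTwo * sqrtTwo = 2 := by
  unfold sqrtTwo
  rw [← Complex.ofReal_mul, Real.mul_self_sqrt (by norm_num)]; simp

theorem sqrtTwo_inv_mul_self : sqrtTwo⁻¹ * sqrtTwo⁻¹ = 1 / 2 := by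
  rw [← mul_inv, sqrtTwo_mul_self]; norm_num

theorem f_eq (n : ℤ) : f n = sqrtTwo⁻¹ • (b n + (-Complex.I) • bHat n) := by
  refine end_ext fun v => ?_
  simp [f, sub_eq_add_neg]

theorem psi1_eq (j : ℤ) :
    psi1 j = sqrtTwo⁻¹ • (psiOf b j + (-Complex.I) • psiOf bHat j) := by
  have : psi1 j = f (idx j) := by unfold psi1 idx; split_ifs <;> rfl
  rw [this, f_eq]; rfl

theorem psi1Dag_eq (j : ℤ) :
    psi1Dag j = sqrtTwo⁻¹ • (psiDagOf b j + Complex.I • psiDagOf bHat j) := by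
  have : psi1Dag j = fDag (idx j) := by unfold psi1Dag idx; split_ifs <;> rfl
  rw [this, fDag, psiDagOf, psiDagOf, smul_comm Complex.I, ← smul_add, smul_smul, mul_comm]

theorem psi2_eq (j : ℤ) :
    psi2 (-1 - j) = sqrtTwo⁻¹ • (psiDagOf b j + (-Complex.I) • psiDagOf bHat j) := by
  have : psi2 (-1 - j) = (-1 : ℂ) ^ idx j • f (-idx j) := by
    rw [neg_one_zpow_idx]
    unfold psi2 idx
    by_cases h : 0 ≤ j
    · rw [if_neg (by omega), if_pos h, if_pos h,
        show 2 * (-1 - j) + 1 = -(2 * j + 1) by ring]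
      exact end_ext fun v => by simp
    · rw [if_pos (by omega), if_neg h, if_neg h, one_smul]
      congr 1; ring
  rw [this, f_eq, psiDagOf, psiDagOf, smul_comm (-Complex.I), ← smul_add, smul_comm]

theorem psi2Dag_eq (j : ℤ) :
    psi2Dag (-1 - j) = sqrtTwo⁻¹ • (psiOf b j + Complex.I • psiOf bHat j) := by
  have : psi2Dag (-1 - j) = (-1 : ℂ) ^ idx j • fDag (-idx j) := by
    rw [neg_one_zpow_idx]
    unfold psi2Dag idx
    by_cases h : 0 ≤ j
    · rw [if_neg (by omega), if_pos h, if_pos h,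
        show 2 * (-1 - j) + 1 = -(2 * j + 1) by ring]
      exact end_ext fun v => by simp
    · rw [if_pos (by omega), if_neg h, if_neg h, one_smul]
      congr 1; ring
  rw [this, fDag, neg_neg, smul_smul, ← mul_assoc, zpow_neg,
    mul_inv_cancel₀ (zpow_ne_zero _ (by norm_num)), one_mul]
  rfl

/-- `psi1 j` and `psi2Dag (-1 - j)` are the combinations `b ∓ i bHat` of the same modes, so the sum
retains only the `b` part. -/
theorem psi_eq (j : ℤ) : psi j = psiOf b j := by
  unfold psi
  rw [psi1_eq, psi2Dag_eq, ← smul_add, smul_smul, sqrtTwo_inv_mul_self]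
  refine end_ext fun v => ?_
  simp only [LinearMap.smul_apply, LinearMap.add_apply]
  module

theorem psiDag_eq (j : ℤ) : psiDag j = psiDagOf b j := by
  unfold psiDag
  rw [psi1Dag_eq, psi2_eq, ← smul_add, smul_smul, sqrtTwo_inv_mul_self]
  refine end_ext fun v => ?_
  simp only [LinearMap.smul_apply, LinearMap.add_apply]
  module

theorem phi_eq : phi = b 0 := by
  unfold phi
  rw [f_eq, fDag, zpow_zero, one_mul, neg_zero, ← smul_add, smul_smul, sqrtTwo_inv_mul_self]
  refine end_ext fun v => ?_
  simp only [LinearMap.smul_apply, LinearMap.add_apply]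
  module

/-! ## Currents -/

/-- On every basis vector only finitely many terms are nonzero. -/
def LocallyFinite (T : ℤ → Module.End ℂ Fock) : Prop :=
  ∀ v, (Function.support fun l => T l (ket v)).Finite

theorem locSum_ket (T : ℤ → Module.End ℂ Fock) (v : Finset ℤ) :
    locSum T (ket v) = ∑ᶠ l, T l (ket v) := by
  simp [locSum, ket]

/-- `A l` annihilates every vector for small `l`. -/
def LowKill (A : ℤ → Module.End ℂ Fock) : Prop := ∀ v, ∃ N : ℤ, ∀ l < N, A l (ket v) = 0

theorem LowKill.add {A C : ℤ → Module.End ℂ Fock} (hA : LowKill A) (hC : LowKill C) :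
    LowKill fun l => A l + C l := fun v => by
  obtain ⟨M, hM⟩ := hA v
  obtain ⟨N, hN⟩ := hC v
  exact ⟨min M N, fun l hl => by
    simp [hM l (hl.trans_le (min_le_left _ _)), hN l (hl.trans_le (min_le_right _ _))]⟩

theorem LowKill.smul {A : ℤ → Module.End ℂ Fock} (hA : LowKill A) (z : ℤ → ℂ) :
    LowKill fun l => z l • A l := fun v => by
  obtain ⟨M, hM⟩ := hA v
  exact ⟨M, fun l hl => by simp [hM l hl]⟩

theorem toggleOp_ket_eq_zero {k : ℤ} {v : Finset ℤ} (h : k ∉ v) (p : ℂ) :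
    toggleOp k p 0 (ket v) = 0 := by
  simp [toggleOp_ket, h]

theorem exists_lt_notMem (v : Finset ℤ) : ∃ N ≤ 0, ∀ n < N, |n| ∉ v ∧ -|n| ∉ v := by
  refine ⟨-∑ k ∈ v, |k|, neg_nonpos.2 (Finset.sum_nonneg fun k _ => abs_nonneg k), fun n hn => ?_⟩
  have h : ∀ k ∈ v, |k| ≤ ∑ k ∈ v, |k| := fun k hk =>
    Finset.single_le_sum (f := fun k : ℤ => |k|) (fun k _ => abs_nonneg k) hk
  have h' := neg_le_abs n
  constructor <;> intro hk <;> have := h _ hk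
  · rw [abs_abs] at this; omega
  · rw [abs_neg, abs_abs] at this; omega

theorem lowKill_b : LowKill b := fun v => by
  obtain ⟨N, hN, h⟩ := exists_lt_notMem v
  refine ⟨N, fun n hn => ?_⟩
  have : bCre n = 0 := by simp [bCre, show ¬ 0 < n by omega, show n < 0 by omega]
  rw [b_eq, this, toggleOp_ket_eq_zero (h n hn).1]

theorem lowKill_bHat : LowKill bHat := fun v => by
  obtain ⟨N, hN, h⟩ := exists_lt_notMem v
  refine ⟨N, fun n hn => ?_⟩
  have : bCre n = 0 := by simp [bCre, show ¬ 0 < n by omega, show n < 0 by omega]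
  rw [bHat_eq, this, mul_zero, toggleOp_ket_eq_zero (h n hn).2]

theorem LowKill.psiOf {e : ℤ → Module.End ℂ Fock} (he : LowKill e) : LowKill (psiOf e) := fun v => by
  obtain ⟨N, h⟩ := he v
  exact ⟨min N 0, fun l hl => h _ (by
    unfold idx; have := min_le_left N 0; have := min_le_right N 0; split_ifs <;> omega)⟩

theorem LowKill.psiDagOf {e : ℤ → Module.End ℂ Fock} (he : LowKill e) :
    LowKill fun l => psiDagOf e (-l) := fun v => by
  obtain ⟨N, h⟩ := he v
  refine ⟨min N 0, fun l hl => ?_⟩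
  change ((-1 : ℂ) ^ idx (-l) • e (-idx (-l))) (ket v) = 0
  rw [LinearMap.smul_apply, h, smul_zero]
  unfold idx; have := min_le_left N 0; have := min_le_right N 0; split_ifs <;> omega

theorem nord_apply (A C : Module.End ℂ Fock) (x : Fock) :
    nord A C x = A (C x) - vacBra (A (C vac)) • x := by
  simp [nord]

theorem nord_swap {A C : Module.End ℂ Fock} (h : Anticomm A C) (x : Fock) :
    nord C A x = -nord A C x := by
  have h1 : ∀ y, C (A y) = -A (C y) := fun y =>
    eq_neg_of_add_eq_zero_right (congrArg (fun M : Module.End ℂ Fock => M y) h)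
  rw [nord_apply, nord_apply, h1, h1, map_neg, neg_smul]
  abel

/-- For large `l` the right factor kills the vector; for small `l` the left factor does, after a
swap allowed because `k ≠ 0`. Both must kill the vacuum too, because of the subtracted expectation,
hence the bounds for `∅`. -/
theorem locallyFinite_nord {A C : ℤ → Module.End ℂ Fock} (hA : LowKill A)
    (hC : LowKill fun l => C (-l)) (h : ∀ i j, i ≠ j → Anticomm (A i) (C j)) {k : ℤ} (hk : k ≠ 0) :
    LocallyFinite fun l => nord (A l) (C (l + k)) := by
  intro v
  obtain ⟨M, hM⟩ := hA v
  obtain ⟨M', hM'⟩ := hA ∅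
  obtain ⟨N, hN⟩ := hC v
  obtain ⟨N', hN'⟩ := hC ∅
  refine (Set.finite_Icc (min M M') (-min N N' - k)).subset fun l hl => ?_
  rw [Function.mem_support] at hl
  by_contra hl'
  rw [Set.mem_Icc, not_and_or, not_le, not_le] at hl'
  apply hl
  change nord (A l) (C (l + k)) (ket v) = 0
  rcases hl' with hl' | hl'
  · have h1 := hM l (hl'.trans_le (min_le_left _ _))
    have h2 : A l vac = 0 := hM' l (hl'.trans_le (min_le_right _ _))
    rw [← neg_neg (nord (A l) _ _), ← nord_swap (h l (l + k) (by omega)), nord_apply, h1, h2]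
    simp
  · have h3 := min_le_left N N'
    have h4 := min_le_right N N'
    have h1 : C (- -(l + k)) (ket v) = 0 := hN (-(l + k)) (by omega)
    have h2 : C (- -(l + k)) vac = 0 := hN' (-(l + k)) (by omega)
    rw [neg_neg] at h1 h2
    rw [nord_apply, h1, h2]
    simp

theorem psiOf_b_anticomm {i j : ℤ} (h : i ≠ j) : Anticomm (psiOf b i) (psiDagOf b j) :=
  (b_anticomm (idx_add_neg_ne_zero h)).smul_right _

theorem psiOf_bHat_anticomm {i j : ℤ} (h : i ≠ j) : Anticomm (psiOf bHat i) (psiDagOf bHat j) :=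
  (bHat_anticomm (idx_add_neg_ne_zero h)).smul_right _

theorem locallyFinite_beta {k : ℤ} (hk : k ≠ 0) :
    LocallyFinite fun l => nord (psiOf b l) (psiDagOf b (l + k)) :=
  locallyFinite_nord lowKill_b.psiOf lowKill_b.psiDagOf (fun _ _ => psiOf_b_anticomm) hk

theorem locallyFinite_betaHat {k : ℤ} (hk : k ≠ 0) :
    LocallyFinite fun l => nord (psiOf bHat l) (psiDagOf bHat (l + k)) :=
  locallyFinite_nord lowKill_bHat.psiOf lowKill_bHat.psiDagOf (fun _ _ => psiOf_bHat_anticomm) hk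

theorem beta_eq (k : ℤ) : beta k = locSum fun l => nord (psiOf b l) (psiDagOf b (l + k)) := by
  unfold beta current
  simp only [psi_eq, psiDag_eq]

theorem hatOp_beta {k : ℤ} (hk : k ≠ 0) :
    hatOp (beta k) = locSum fun l => nord (psiOf bHat l) (psiDagOf bHat (l + k)) := by
  rw [beta_eq]
  refine conj_eq_of_rot _ fun v => ?_
  rw [rot_ket, map_smul, locSum_ket, locSum_ket]
  have h1 := (rot phase phase_ne_zero).toLinearMap.toAddMonoidHom.map_finsum
    (locallyFinite_beta hk v)
  have h2 : ∀ l, rot phase phase_ne_zero (nord (psiOf b l) (psiDagOf b (l + k)) (ket v)) =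
      theta phase v • nord (psiOf bHat l) (psiDagOf bHat (l + k)) (ket (refl v)) := by
    intro l
    rw [← conj_rot, conj_nord, rot_ket, map_smul, ← hatOp_psiOf, ← hatOp_psiDagOf]
  refine h1.trans ?_
  rw [smul_finsum]
  exact finsum_congr h2

/-- Since `t * t = -1`, anticommuting the second product into the order of the first makes the mixed
terms `a c'` and `a' c` cancel, while the `a c` and `a' c'` terms double, compensating `s * s = 1 /
2`. The vacuum expectations combine in the same way. -/
theorem nord_alpha {s t : ℂ} (hs : s * s = 1 / 2) (ht : t * t = -1)
    {a a' c c' : Module.End ℂ Fock} (h₁ : Anticomm a c)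
    (h₂ : Anticomm a c') (h₃ : Anticomm a' c) (h₄ : Anticomm a' c') (x : Fock) :
    nord (s • (a + (-t) • a')) (s • (c + t • c')) x -
      nord (s • (c + (-t) • c')) (s • (a + t • a')) x = nord a c x + nord a' c' x := by
  have hsw : ∀ {A C : Module.End ℂ Fock}, Anticomm A C → ∀ y, C (A y) = -A (C y) := fun h y =>
    eq_neg_of_add_eq_zero_right (congrArg (fun M : Module.End ℂ Fock => M y) h)
  have hlin : ∀ y : Fock, (s • (c + (-t) • c')) ((s • (a + t • a')) y) =
      (s * s) • (-a (c y) + -(t • a' (c y)) + t • a (c' y) + (t * t) • a' (c' y)) := by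
    intro y
    simp only [LinearMap.smul_apply, LinearMap.add_apply, map_add, map_smul, hsw h₁, hsw h₂,
      hsw h₃, hsw h₄]
    module
  have hlin' : ∀ y : Fock, (s • (a + (-t) • a')) ((s • (c + t • c')) y) =
      (s * s) • (a (c y) + -(t • a' (c y)) + t • a (c' y) + -((t * t) • a' (c' y))) := by
    intro y
    simp only [LinearMap.smul_apply, LinearMap.add_apply, map_add, map_smul]
    module
  simp only [nord_apply, hlin, hlin', hs, ht, map_add, map_smul, map_neg, smul_eq_mul]
  module

theorem alpha_sub {k : ℤ} (hk : k ≠ 0) :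
    alpha1 k + (-1 : ℂ) • alpha2 k = beta k + hatOp (beta k) := by
  have hII : Complex.I * Complex.I = -1 := Complex.I_mul_I
  have hpair : ∀ i j, i ≠ j → ∀ p q : ℂ, Anticomm (sqrtTwo⁻¹ • (psiOf b i + p • psiOf bHat i))
      (sqrtTwo⁻¹ • (psiDagOf b j + q • psiDagOf bHat j)) := by
    intro i j hij p q
    refine Anticomm.smul_left (Anticomm.smul_right (Anticomm.add_left
      (Anticomm.add_right (psiOf_b_anticomm hij) ?_)
      (Anticomm.smul_left (Anticomm.add_right ?_ ((psiOf_bHat_anticomm hij).smul_right _)) _)) _) _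
    · exact ((b_bHat_anticomm _ _).smul_right _).smul_right _
    · exact (b_bHat_anticomm _ _).symm.smul_right _
  have hA : ∀ p : ℂ, LowKill fun i => sqrtTwo⁻¹ • (psiOf b i + p • psiOf bHat i) := fun p =>
    (lowKill_b.psiOf.add (lowKill_bHat.psiOf.smul fun _ => p)).smul fun _ => sqrtTwo⁻¹
  have hC : ∀ p : ℂ, LowKill fun i => sqrtTwo⁻¹ • (psiDagOf b (-i) + p • psiDagOf bHat (-i)) :=
    fun p => (lowKill_b.psiDagOf.add (lowKill_bHat.psiDagOf.smul fun _ => p)).smul fun _ => sqrtTwo⁻¹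
  have h1 : LocallyFinite fun l => nord (psi1 l) (psi1Dag (l + k)) := by
    simp only [psi1_eq, psi1Dag_eq]
    exact locallyFinite_nord (hA _) (hC _) (fun i j hij => hpair i j hij _ _) hk
  have h2 : LocallyFinite fun l => nord (psi2 (-1 - (l + k))) (psi2Dag (-1 - l)) := by
    intro v
    simp only [psi2_eq, psi2Dag_eq]
    refine (locallyFinite_nord (hA Complex.I) (hC (-Complex.I)) (fun i j hij => hpair i j hij _ _)
      hk v).subset fun l hl => ?_
    rw [Function.mem_support, nord_swap (hpair l (l + k) (by omega) _ _)] at hl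
    exact fun h0 => hl (neg_eq_zero.2 h0)
  rw [hatOp_beta hk, beta_eq]
  refine end_ext fun v => ?_
  rw [LinearMap.add_apply, LinearMap.add_apply, LinearMap.smul_apply, alpha1, alpha2, current,
    current, locSum_ket, locSum_ket, locSum_ket, locSum_ket]
  -- The reindexing `l ↦ -1 - k - l` puts into each term of `alpha2` the same neutral modes as in
  -- the `l`-th term of `alpha1`.
  have h3 : ∑ᶠ l, nord (psi2 l) (psi2Dag (l + k)) (ket v) =
      ∑ᶠ l, nord (psi2 (-1 - (l + k))) (psi2Dag (-1 - l)) (ket v) := by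
    rw [← finsum_comp_equiv (Equiv.subLeft (-1 - k))]
    refine finsum_congr fun l => ?_
    simp only [Equiv.subLeft_apply]
    rw [show -1 - k - l = -1 - (l + k) by ring, show -1 - (l + k) + k = -1 - l by ring]
  rw [h3, ← finsum_add_distrib (locallyFinite_beta hk v) (locallyFinite_betaHat hk v), neg_one_smul,
    ← sub_eq_add_neg, ← finsum_sub_distrib (h1 v) (h2 v)]
  refine finsum_congr fun l => ?_
  beta_reduce
  rw [psi1_eq, psi1Dag_eq, psi2_eq, psi2Dag_eq]
  have hl : l ≠ l + k := by omega
  exact nord_alpha sqrtTwo_inv_mul_self hII (psiOf_b_anticomm hl)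
    ((b_bHat_anticomm _ _).smul_right _) ((b_bHat_anticomm _ _).symm.smul_right _)
    (psiOf_bHat_anticomm hl) _

/-! ### Transposes of the currents and their membership in the local algebras -/

theorem nord_isTranspose {A A' C C' : Module.End ℂ Fock} (hA : IsTranspose A A')
    (hC : IsTranspose C C') : IsTranspose (nord A C) (nord C' A') := by
  intro v w
  have h1 := hA.mul hC v w
  have h2 : vacBra (A (C vac)) = vacBra (C' (A' vac)) := hA.mul hC ∅ ∅
  simp only [Module.End.mul_apply] at h1
  rw [nord_apply, nord_apply, h2, Finsupp.sub_apply, Finsupp.sub_apply, h1, Finsupp.smul_apply,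
    Finsupp.smul_apply, ket_apply, ket_apply]
  simp only [eq_comm]

theorem psiOf_isTranspose (j : ℤ) : IsTranspose (psiOf b j) (psiDagOf b j) := b_isTranspose _

theorem beta_isTranspose {k : ℤ} (hk : k ≠ 0) : IsTranspose (beta k) (beta (-k)) := by
  intro v w
  rw [beta_eq, beta_eq, locSum_ket, locSum_ket]
  have hf : ∀ {T : ℤ → Module.End ℂ Fock} (_ : LocallyFinite T) (v w : Finset ℤ),
      (∑ᶠ l, T l (ket w)) v = ∑ᶠ l, T l (ket w) v := fun hT v w =>
    (Finsupp.applyAddHom v).map_finsum (hT w)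
  rw [hf (locallyFinite_beta hk), hf (locallyFinite_beta (neg_ne_zero.2 hk)),
    ← finsum_comp_equiv (Equiv.addRight k) (f := fun l =>
      nord (psiOf b l) (psiDagOf b (l + -k)) (ket v) w)]
  refine finsum_congr fun l => ?_
  simp only [Equiv.coe_addRight, add_neg_cancel_right]
  exact nord_isTranspose (psiOf_isTranspose l) (psiOf_isTranspose (l + k)).symm v w

theorem nord_mem_evenAlg (j k : ℤ) : nord (psiOf b j) (psiDagOf b k) ∈ evenAlg b := by
  have h : psiOf b j * psiDagOf b k ∈ evenAlg b := by
    unfold psiOf psiDagOf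
    rw [mul_smul_comm]
    exact Subalgebra.smul_mem _ (mul_mem_evenAlg b _ _) _
  have : nord (psiOf b j) (psiDagOf b k) = psiOf b j * psiDagOf b k +
      (-vacBra ((psiOf b j * psiDagOf b k) vac)) • 1 := end_ext fun v => by
    simp [nord, sub_eq_add_neg]
  rw [this]
  exact add_mem h (Subalgebra.smul_mem _ (one_mem _) _)

/-- Finitely many vectors involve finitely many basis vectors, each seeing finitely many terms, so
one finite partial sum agrees with the whole on all of them. -/
theorem locSum_mem_localAlg {e T : ℤ → Module.End ℂ Fock} (hT : LocallyFinite T)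
    (h : ∀ l, T l ∈ evenAlg e) : locSum T ∈ localAlg e := by
  classical
  intro F
  set G : Finset (Finset ℤ) := F.biUnion fun y => y.support with hG
  set s : Finset ℤ := G.biUnion fun v => (hT v).toFinset with hs
  refine ⟨∑ l ∈ s, T l, sum_mem fun l _ => h l, fun y hy => ?_⟩
  have hket : ∀ v ∈ G, locSum T (ket v) = (∑ l ∈ s, T l) (ket v) := by
    intro v hv
    rw [locSum_ket, LinearMap.sum_apply]
    refine finsum_eq_sum_of_support_subset _ fun l hl => ?_
    rw [Finset.mem_coe, hs, Finset.mem_biUnion]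
    exact ⟨v, hv, by simpa using hl⟩
  have hy' : y = ∑ v ∈ y.support, y v • ket v := by
    conv_lhs => rw [← Finsupp.sum_single y]
    exact Finset.sum_congr rfl fun v _ => by simp [ket]
  rw [hy', map_sum, map_sum]
  refine Finset.sum_congr rfl fun v hv => ?_
  rw [map_smul, map_smul, hket v (Finset.mem_biUnion.2 ⟨y, hy, hv⟩)]

theorem beta_mem_localAlg {k : ℤ} (hk : k ≠ 0) : beta k ∈ localAlg b := by
  rw [beta_eq]
  exact locSum_mem_localAlg (locallyFinite_beta hk) fun l => nord_mem_evenAlg _ _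

theorem beta_mem_rowFiniteAlg {k : ℤ} (hk : k ≠ 0) : beta k ∈ rowFiniteAlg :=
  ⟨beta_mem_localAlg hk, _, beta_mem_localAlg (neg_ne_zero.2 hk), beta_isTranspose hk⟩

/-! ## Charged vacua -/

theorem list_prod_mul_anticomm {R : Type*} [Ring R] [Algebra ℂ R] {ι : Type*} (x : ι → R) (y : R)
    (h : ∀ j, Anticomm (x j) y) (l : List ι) :
    (l.map x).prod * y = (-1 : ℂ) ^ l.length • (y * (l.map x).prod) := by
  induction l with
  | nil => simp
  | cons j l ih =>
    rw [List.map_cons, List.prod_cons, List.length_cons, mul_assoc, ih, mul_smul_comm, ← mul_assoc,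
      (h j).mul_eq, pow_succ, neg_mul, mul_assoc, mul_neg_one, neg_smul, smul_neg]

/-- For one index the squares vanish and the cross terms give `s² (x + t y)(x - t y) = -t x y`. In
the induction, the sign from moving the new factor past the first product is undone by moving `y j`
past the product of the `x`'s. -/
theorem list_prod_charged {R : Type*} [Ring R] [Algebra ℂ R] {ι : Type*} (x y : ι → R)
    (hx : ∀ i j, Anticomm (x i) (x j)) (hy : ∀ i j, Anticomm (y i) (y j))
    (hxy : ∀ i j, Anticomm (x i) (y j)) {s : ℂ} (hs : s * s = 1 / 2) (t : ℂ) (l : List ι) :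
    (l.map fun j => s • (x j + t • y j)).prod * (l.map fun j => s • (x j + (-t) • y j)).prod =
      (-t) ^ l.length • ((l.map x).prod * (l.map y).prod) := by
  have hsq : ∀ z : R, Anticomm z z → z * z = 0 := fun z hz => by
    have h2 : (2 : ℂ) • (z * z) = 0 := by rw [two_smul]; exact hz
    exact (smul_eq_zero.1 h2).resolve_left two_ne_zero
  induction l with
  | nil => simp
  | cons j l ih =>
    have h1 := list_prod_mul_anticomm (fun j => s • (x j + t • y j)) (s • (x j + (-t) • y j))
      (fun i => ((((hx i j).add_right ((hxy i j).smul_right _)).add_left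
        (((hxy j i).symm.add_right ((hy i j).smul_right _)).smul_left _)).smul_right _).smul_left _) l
    have h2 := list_prod_mul_anticomm x (y j) (fun i => hxy i j) l
    have h3 : s • (x j + t • y j) * s • (x j + (-t) • y j) = (-t) • (x j * y j) := by
      rw [smul_mul_smul_comm, hs, add_mul, mul_add, mul_add, hsq _ (hx j j), mul_smul_comm,
        smul_mul_assoc, smul_mul_smul_comm, hsq _ (hy j j), (hxy j j).symm.mul_eq]
      module
    simp only [List.map_cons, List.prod_cons, List.length_cons]
    generalize (List.map (fun j => s • (x j + t • y j)) l).prod = P at *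
    generalize (List.map (fun j => s • (x j + (-t) • y j)) l).prod = Q at *
    generalize (List.map x l).prod = X at *
    generalize (List.map y l).prod = Y at *
    generalize s • (x j + t • y j) = p at *
    generalize s • (x j + (-t) • y j) = q at *
    calc p * P * (q * Q) = p * (P * q) * Q := by noncomm_ring
      _ = (-1 : ℂ) ^ l.length • (p * q * (P * Q)) := by
        rw [h1, mul_smul_comm, smul_mul_assoc]; congr 1; noncomm_ring
      _ = ((-1 : ℂ) ^ l.length * ((-t) * (-t) ^ l.length)) • (x j * y j * (X * Y)) := by
        rw [h3, ih, smul_mul_smul_comm, smul_smul]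
      _ = (-t) ^ (l.length + 1) • (x j * ((-1 : ℂ) ^ l.length • (y j * X)) * Y) := by
        rw [mul_smul_comm, smul_mul_assoc, smul_smul, pow_succ]
        congr 1
        · ring
        · noncomm_ring
      _ = _ := by rw [← h2]; congr 1; noncomm_ring

section Lists

variable (a aDag : ℤ → Module.End ℂ Fock) (p : ℕ)

theorem Psi_natCast : Psi a aDag p = ((List.range p).reverse.map fun j : ℕ => a (j : ℤ)).prod := by
  simp [Psi]

theorem PsiDag_natCast : PsiDag a aDag p = ((List.range p).map fun j : ℕ => aDag (j : ℤ)).prod := by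
  simp [PsiDag]

theorem Psi_neg_natCast :
    Psi a aDag (-p) = ((List.range p).reverse.map fun j : ℕ => aDag (-1 - (j : ℤ))).prod := by
  rcases Nat.eq_zero_or_pos p with rfl | hp
  · simp [Psi]
  · have h0 : ¬ (0 : ℤ) ≤ -(p : ℤ) := by omega
    rw [Psi, if_neg h0, neg_neg, Int.toNat_natCast]
    congr 1
    refine List.ext_getElem (by simp) fun i h1 h2 => ?_
    simp only [List.length_map, List.length_range] at h1
    simp only [List.getElem_map, List.getElem_range, List.getElem_reverse, List.length_range]
    congr 1; omega

theorem PsiDag_neg_natCast :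
    PsiDag a aDag (-p) = ((List.range p).map fun j : ℕ => a (-1 - (j : ℤ))).prod := by
  rcases Nat.eq_zero_or_pos p with rfl | hp
  · simp [PsiDag]
  · have h0 : ¬ (0 : ℤ) ≤ -(p : ℤ) := by omega
    rw [PsiDag, if_neg h0, neg_neg, Int.toNat_natCast]

end Lists

theorem psiOf_list_prod (g : ℕ → ℤ) (l : List ℕ) (t : ℂ) :
    (l.map fun j => sqrtTwo⁻¹ • (psiOf b (g j) + t • psiOf bHat (g j))).prod *
      (l.map fun j => sqrtTwo⁻¹ • (psiOf b (g j) + (-t) • psiOf bHat (g j))).prod =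
      (-t) ^ l.length • ((l.map fun j => psiOf b (g j)).prod *
        hatOp (l.map fun j => psiOf b (g j)).prod) := by
  rw [map_list_prod, List.map_map]
  have : (hatOp ∘ fun j => psiOf b (g j)) = fun j => psiOf bHat (g j) :=
    funext fun j => hatOp_psiOf _
  rw [this]
  exact list_prod_charged (fun j => psiOf b (g j)) (fun j => psiOf bHat (g j))
    (fun i j => b_anticomm (idx_add_ne_zero _ _)) (fun i j => bHat_anticomm (idx_add_ne_zero _ _))
    (fun i j => b_bHat_anticomm _ _) sqrtTwo_inv_mul_self t l

theorem psiDagOf_list_prod (g : ℕ → ℤ) (l : List ℕ) (t : ℂ) :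
    (l.map fun j => sqrtTwo⁻¹ • (psiDagOf b (g j) + t • psiDagOf bHat (g j))).prod *
      (l.map fun j => sqrtTwo⁻¹ • (psiDagOf b (g j) + (-t) • psiDagOf bHat (g j))).prod =
      (-t) ^ l.length • ((l.map fun j => psiDagOf b (g j)).prod *
        hatOp (l.map fun j => psiDagOf b (g j)).prod) := by
  rw [map_list_prod, List.map_map]
  have : (hatOp ∘ fun j => psiDagOf b (g j)) = fun j => psiDagOf bHat (g j) :=
    funext fun j => hatOp_psiDagOf _
  rw [this]
  have hne : ∀ i j, -idx i + -idx j ≠ 0 := fun i j => by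
    have := idx_add_ne_zero i j; omega
  exact list_prod_charged (fun j => psiDagOf b (g j)) (fun j => psiDagOf bHat (g j))
    (fun i j => ((b_anticomm (hne _ _)).smul_right _).smul_left _)
    (fun i j => ((bHat_anticomm (hne _ _)).smul_right _).smul_left _)
    (fun i j => ((b_bHat_anticomm _ _).smul_right _).smul_left _) sqrtTwo_inv_mul_self t l

theorem psi2Dag_eq' (j : ℤ) :
    psi2Dag j = sqrtTwo⁻¹ • (psiOf b (-1 - j) + Complex.I • psiOf bHat (-1 - j)) := by
  rw [← psi2Dag_eq]; congr 1; ring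

theorem psi2_eq' (j : ℤ) :
    psi2 j = sqrtTwo⁻¹ • (psiDagOf b (-1 - j) + (-Complex.I) • psiDagOf bHat (-1 - j)) := by
  rw [← psi2_eq]; congr 1; ring

theorem PsiDag_charged (n : ℤ) :
    PsiDag psi1 psi1Dag n * PsiDag psi2 psi2Dag (-n) =
      (-Complex.I) ^ n • (PsiDag psi psiDag n * hatOp (PsiDag psi psiDag n)) := by
  obtain ⟨p, rfl | rfl⟩ := n.eq_nat_or_neg
  · rw [PsiDag_natCast, PsiDag_neg_natCast, PsiDag_natCast]
    simp only [psi1Dag_eq, psi2_eq, psiDag_eq]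
    rw [psiDagOf_list_prod (fun j => (j : ℤ)), List.length_range, zpow_natCast]
  · rw [neg_neg, PsiDag_neg_natCast, PsiDag_natCast, PsiDag_neg_natCast]
    simp only [psi1_eq, psi2Dag_eq', psi_eq]
    have := psiOf_list_prod (fun j => -1 - (j : ℤ)) (List.range p) (-Complex.I)
    rw [neg_neg] at this
    rw [this, List.length_range, zpow_neg, zpow_natCast, ← inv_pow, inv_neg, Complex.inv_I, neg_neg]

theorem Psi_charged (n : ℤ) :
    Psi psi2 psi2Dag (-n) * Psi psi1 psi1Dag n =
      (-Complex.I) ^ n • (Psi psi psiDag n * hatOp (Psi psi psiDag n)) := by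
  obtain ⟨p, rfl | rfl⟩ := n.eq_nat_or_neg
  · rw [Psi_natCast, Psi_neg_natCast, Psi_natCast]
    simp only [psi2Dag_eq, psi1_eq, psi_eq]
    rw [psiOf_list_prod (fun j => (j : ℤ)), List.length_reverse, List.length_range, zpow_natCast]
  · rw [neg_neg, Psi_neg_natCast, Psi_natCast, Psi_neg_natCast]
    simp only [psi2_eq', psi1Dag_eq, psiDag_eq]
    have := psiDagOf_list_prod (fun j => -1 - (j : ℤ)) (List.range p).reverse (-Complex.I)
    rw [neg_neg] at this
    rw [this, List.length_reverse, List.length_range, zpow_neg, zpow_natCast, ← inv_pow, inv_neg,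
      Complex.inv_I, neg_neg]


/-! ### Bra and ket vectors from even operators, and the charge-dependent signs -/

theorem list_prod_mem_evenAlg (l : List (ℂ × ℤ)) :
    (Even l.length → (l.map fun q => q.1 • b q.2).prod ∈ evenAlg b) ∧
      (Odd l.length → ∀ k, b k * (l.map fun q => q.1 • b q.2).prod ∈ evenAlg b) := by
  induction l with
  | nil => exact ⟨fun _ => one_mem _, fun h => absurd h (by simp)⟩
  | cons q l ih =>
    rw [List.map_cons, List.prod_cons, List.length_cons, Nat.even_add_one, Nat.odd_add_one,
      Nat.not_even_iff_odd, Nat.not_odd_iff_even]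
    constructor
    · intro h
      rw [smul_mul_assoc]
      exact Subalgebra.smul_mem _ (ih.2 h _) _
    · intro h k
      rw [smul_mul_assoc, mul_smul_comm, ← mul_assoc]
      exact Subalgebra.smul_mem _ (mul_mem (mul_mem_evenAlg _ _ _) (ih.1 h)) _

theorem list_prod_mul_mem_evenAlg (l : List (ℂ × ℤ)) (h : Odd l.length) (k : ℤ) :
    (l.map fun q => q.1 • b q.2).prod * b k ∈ evenAlg b := by
  have h1 := (list_prod_mem_evenAlg (l ++ [(1, k)])).1 (by
    rw [List.length_append, List.length_singleton, Nat.even_add_one, Nat.not_even_iff_odd]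
    exact h)
  simpa using h1

theorem Psi_eq_list_prod (n : ℤ) : ∃ l : List (ℂ × ℤ),
    Psi psi psiDag n = (l.map fun q => q.1 • b q.2).prod ∧ (Even n ↔ Even l.length) := by
  obtain ⟨p, rfl | rfl⟩ := n.eq_nat_or_neg
  · refine ⟨(List.range p).reverse.map fun j : ℕ => (1, idx j), ?_, by simp⟩
    rw [Psi_natCast, List.map_map]
    congr 1
    exact List.map_congr_left fun j _ => by simp [psi_eq, psiOf]
  · refine ⟨(List.range p).reverse.map fun j : ℕ =>
      ((-1) ^ idx (-1 - (j : ℤ)), -idx (-1 - (j : ℤ))), ?_, by simp⟩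
    rw [Psi_neg_natCast, List.map_map]
    congr 1
    exact List.map_congr_left fun j _ => by simp [psiDag_eq, psiDagOf]

theorem PsiDag_eq_list_prod (n : ℤ) : ∃ l : List (ℂ × ℤ),
    PsiDag psi psiDag n = (l.map fun q => q.1 • b q.2).prod ∧ (Even n ↔ Even l.length) := by
  obtain ⟨p, rfl | rfl⟩ := n.eq_nat_or_neg
  · refine ⟨(List.range p).map fun j : ℕ => ((-1) ^ idx j, -idx j), ?_, by simp⟩
    rw [PsiDag_natCast, List.map_map]
    congr 1
    exact List.map_congr_left fun j _ => by simp [psiDag_eq, psiDagOf]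
  · refine ⟨(List.range p).map fun j : ℕ => (1, idx (-1 - (j : ℤ))), ?_, by simp⟩
    rw [PsiDag_neg_natCast, List.map_map]
    congr 1
    exact List.map_congr_left fun j _ => by simp [psi_eq, psiOf]

/-- The operator creating `ketB n` from the vacuum. -/
def ketOp (n : ℤ) : Module.End ℂ Fock :=
  if Even n then Psi psi psiDag n else sqrtTwo • (Psi psi psiDag n * phi)

/-- The operator creating `braB n` from the dual vacuum. -/
def braOp (n : ℤ) : Module.End ℂ Fock :=
  if Even n then PsiDag psi psiDag n else sqrtTwo • (phi * PsiDag psi psiDag n)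

theorem ketB_eq (n : ℤ) : ketB n = ketOp n vac := by
  unfold ketB ketOp; split_ifs <;> rfl

theorem braB_eq (n : ℤ) : braB n = vacBra ∘ₗ braOp n := by
  unfold braB braOp; split_ifs <;> rfl

theorem ketOp_mem (n : ℤ) : ketOp n ∈ evenAlg b := by
  obtain ⟨l, h, hl⟩ := Psi_eq_list_prod n
  unfold ketOp
  rw [h, phi_eq]
  split_ifs with hn
  · exact (list_prod_mem_evenAlg l).1 (hl.1 hn)
  · exact Subalgebra.smul_mem _ (list_prod_mul_mem_evenAlg l
      (Nat.not_even_iff_odd.1 fun h' => hn (hl.2 h')) 0) _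

theorem braOp_mem (n : ℤ) : braOp n ∈ evenAlg b := by
  obtain ⟨l, h, hl⟩ := PsiDag_eq_list_prod n
  unfold braOp
  rw [h, phi_eq]
  split_ifs with hn
  · exact (list_prod_mem_evenAlg l).1 (hl.1 hn)
  · exact Subalgebra.smul_mem _ ((list_prod_mem_evenAlg l).2
      (Nat.not_even_iff_odd.1 fun h' => hn (hl.2 h')) 0) _

/-- The product toggles the shared mode twice, hence is diagonal; its value on the vacuum,
`(1/√2)(i/√2)`, is the source of the extra `i` at odd charge. -/
theorem b_zero_mul_bHat_zero : ∃ d : Finset ℤ → ℂ, b 0 * bHat 0 = mono ∅ d ∧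
    d ∅ = Complex.I / 2 := by
  refine ⟨_, by rw [b_eq, bHat_eq, abs_zero, neg_zero, toggleOp_mul_self], ?_⟩
  have := sqrtTwo_inv_mul_self
  simp [bAnn, bCre, phase]
  linear_combination Complex.I * this

theorem b_mul_bHat_vac : b 0 (bHat 0 vac) = (Complex.I / 2) • vac := by
  obtain ⟨d, h1, h2⟩ := b_zero_mul_bHat_zero
  rw [← Module.End.mul_apply, h1, vac, mono_ket, h2]
  simp [← Finset.bot_eq_empty]

theorem vacBra_b_mul_bHat (x : Fock) : vacBra (b 0 (bHat 0 x)) = (Complex.I / 2) * vacBra x := by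
  obtain ⟨d, h1, h2⟩ := b_zero_mul_bHat_zero
  rw [← Module.End.mul_apply, h1]
  change mono ∅ d x ∅ = _ * x ∅
  rw [mono_apply, ← Finset.bot_eq_empty, symmDiff_bot, Finset.bot_eq_empty, h2]

theorem sign_even {n : ℤ} (hn : Even n) : (-Complex.I) ^ n = (-1 : ℂ) ^ (n * (n - 1) / 2) := by
  obtain ⟨k, rfl⟩ := hn
  have h1 : (k + k) * (k + k - 1) / 2 = (2 * k - 1) * k := by
    rw [show (k + k) * (k + k - 1) = 2 * ((2 * k - 1) * k) by ring]; simp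
  have h2 : (-1 : ℂ) ^ (2 * k - 1) = -1 := Odd.neg_one_zpow ⟨k - 1, by ring⟩
  rw [h1, zpow_mul, h2, ← two_mul, zpow_mul]
  congr 1
  rw [zpow_ofNat, neg_sq, Complex.I_sq]

theorem sign_odd {n : ℤ} (hn : Odd n) :
    (-Complex.I) ^ n * Complex.I = (-1 : ℂ) ^ (n * (n - 1) / 2) := by
  obtain ⟨k, rfl⟩ := hn
  have h1 : (2 * k + 1) * (2 * k + 1 - 1) / 2 = (2 * k + 1) * k := by
    rw [show (2 * k + 1) * (2 * k + 1 - 1) = 2 * ((2 * k + 1) * k) by ring]; simp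
  have h2 : (-1 : ℂ) ^ (2 * k + 1) = -1 := Odd.neg_one_zpow ⟨k, rfl⟩
  have h3 : (-Complex.I) ^ (2 : ℤ) = -1 := by rw [zpow_ofNat, neg_sq, Complex.I_sq]
  rw [h1, zpow_mul, h2, zpow_add₀ (neg_ne_zero.2 Complex.I_ne_zero), zpow_mul, h3, zpow_one,
    mul_assoc, neg_mul, Complex.I_mul_I, neg_neg, mul_one]

theorem list_prod_bHat (l : List (ℂ × ℤ)) (h : ¬ Even l.length) (x : Fock) :
    (l.map fun q => q.1 • b q.2).prod (bHat 0 x) =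
      -bHat 0 ((l.map fun q => q.1 • b q.2).prod x) := by
  have h1 := list_prod_mul_anticomm (fun q : ℂ × ℤ => q.1 • b q.2) (bHat 0)
    (fun q => (b_bHat_anticomm _ _).smul_left _) l
  rw [(Nat.not_even_iff_odd.1 h).neg_one_pow] at h1
  have h2 := congrArg (fun A : Module.End ℂ Fock => A x) h1
  simpa using h2

theorem list_prod_hat_b (l : List (ℂ × ℤ)) (h : ¬ Even l.length) (x : Fock) :
    hatOp (l.map fun q => q.1 • b q.2).prod (b 0 x) =
      -b 0 (hatOp (l.map fun q => q.1 • b q.2).prod x) := by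
  have h1 := list_prod_mul_anticomm (fun q : ℂ × ℤ => q.1 • bHat q.2) (b 0)
    (fun q => (b_bHat_anticomm _ _).symm.smul_left _) l
  have h3 : hatOp (l.map fun q => q.1 • b q.2).prod = (l.map fun q => q.1 • bHat q.2).prod := by
    rw [map_list_prod, List.map_map]
    congr 1
    exact List.map_congr_left fun q _ => by simp [hatOp_b]
  rw [(Nat.not_even_iff_odd.1 h).neg_one_pow, ← h3] at h1
  have h2 := congrArg (fun A : Module.End ℂ Fock => A x) h1
  simpa using h2

/-- For odd `n`, collecting `φ` and `φ̂` at the vacuum costs `-1` for passing an odd product and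
yields `2 · (i/2)`. This factor `-i` cancels the `i` in `sign_odd`, leaving the `(-i)^n` of
`PsiDag_charged`. -/
theorem bra2_eq (n : ℤ) : bra2 n (0 - n) =
    (-1 : ℂ) ^ (n * (n - 1) / 2) • (vacBra ∘ₗ (braOp n * hatOp (braOp n))) := by
  rw [bra2, zero_sub, PsiDag_charged]
  unfold braOp
  split_ifs with hn
  · rw [sign_even hn, LinearMap.comp_smul]
  · obtain ⟨l, h, hl⟩ := PsiDag_eq_list_prod n
    have hl' : ¬ Even l.length := fun h' => hn (hl.2 h')
    rw [← sign_odd (Int.not_even_iff_odd.1 hn), h, phi_eq, map_smul, map_mul, hatOp_b]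
    refine LinearMap.ext fun x => ?_
    simp only [LinearMap.comp_apply, LinearMap.smul_apply, Module.End.mul_apply, map_smul,
      list_prod_bHat l hl', map_neg, vacBra_b_mul_bHat, smul_eq_mul]
    linear_combination ((-Complex.I) ^ n * Complex.I * (Complex.I / 2) * vacBra
      ((l.map fun q => q.1 • b q.2).prod (hatOp (l.map fun q => q.1 • b q.2).prod x))) *
        sqrtTwo_mul_self + ((-Complex.I) ^ n * vacBra
      ((l.map fun q => q.1 • b q.2).prod (hatOp (l.map fun q => q.1 • b q.2).prod x))) *
        Complex.I_mul_I

theorem ket2_eq (n : ℤ) : ket2 n (0 - n) =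
    (-1 : ℂ) ^ (n * (n - 1) / 2) • (ketOp n (hatOp (ketOp n) vac)) := by
  rw [ket2, zero_sub, Psi_charged]
  unfold ketOp
  split_ifs with hn
  · rw [sign_even hn]; rfl
  · obtain ⟨l, h, hl⟩ := Psi_eq_list_prod n
    have hl' : ¬ Even l.length := fun h' => hn (hl.2 h')
    rw [← sign_odd (Int.not_even_iff_odd.1 hn), h, phi_eq, map_smul, map_mul, hatOp_b]
    have h1 := list_prod_hat_b l hl' (bHat 0 vac)
    rw [b_mul_bHat_vac] at h1
    have h2 : b 0 (hatOp (l.map fun q => q.1 • b q.2).prod (bHat 0 vac)) =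
        -((Complex.I / 2) • hatOp (l.map fun q => q.1 • b q.2).prod vac) := by
      rw [← map_smul, h1, neg_neg]
    simp only [LinearMap.smul_apply, Module.End.mul_apply, map_smul, h2, map_neg, smul_neg,
      smul_smul]
    rw [← neg_smul]
    congr 1
    linear_combination ((-Complex.I) ^ n * Complex.I * (Complex.I / 2)) *
        sqrtTwo_mul_self + ((-Complex.I) ^ n) * Complex.I_mul_I

/-! ## Exponentials of power series -/

section PowerSeries

open MvPowerSeries

variable {σ : Type*}

theorem coeff_mul_eq_zero {R : Type*} [Semiring R] {Y Z : MvPowerSeries σ R} {i j : ℕ}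
    (hY : ∀ μ : σ →₀ ℕ, μ.degree < i → coeff μ Y = 0)
    (hZ : ∀ μ : σ →₀ ℕ, μ.degree < j → coeff μ Z = 0) (μ : σ →₀ ℕ) (hμ : μ.degree < i + j) :
    coeff μ (Y * Z) = 0 := by
  classical
  rw [coeff_mul]
  refine Finset.sum_eq_zero fun p hp => ?_
  rw [Finset.HasAntidiagonal.mem_antidiagonal] at hp
  rw [← hp, map_add] at hμ
  by_cases h : p.1.degree < i
  · rw [hY _ h, zero_mul]
  · rw [hZ p.2 (by omega), mul_zero]

theorem coeff_pow_eq_zero_of_degree_lt {R : Type*} [Semiring R] {Y : MvPowerSeries σ R} (hY : coeff 0 Y = 0)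
    (k : ℕ) : ∀ μ : σ →₀ ℕ, μ.degree < k → coeff μ (Y ^ k) = 0 := by
  induction k with
  | zero => exact fun μ h => absurd h (Nat.not_lt_zero _)
  | succ k ih =>
    rw [pow_succ]
    refine coeff_mul_eq_zero ih fun μ h => ?_
    rw [(Finsupp.degree_eq_zero_iff μ).1 (Nat.lt_one_iff.1 h), hY]

/-- The truncated exponential series. -/
def truncExp (N : ℕ) (Y : MvPowerSeries σ (Module.End ℂ Fock)) :
    MvPowerSeries σ (Module.End ℂ Fock) :=
  ∑ k ∈ Finset.range (N + 1), ((k.factorial : ℂ)⁻¹) • Y ^ k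

theorem coeff_expSeries_eq_sum (Y : MvPowerSeries σ (Module.End ℂ Fock)) (μ : σ →₀ ℕ) :
    coeff μ (expSeries Y) =
      ∑ k ∈ Finset.range (μ.degree + 1), ((k.factorial : ℂ)⁻¹) • coeff μ (Y ^ k) := rfl

theorem coeff_expSeries {Y : MvPowerSeries σ (Module.End ℂ Fock)} (hY : coeff 0 Y = 0) {N : ℕ}
    {μ : σ →₀ ℕ} (hμ : μ.degree ≤ N) : coeff μ (expSeries Y) = coeff μ (truncExp N Y) := by
  rw [truncExp, map_sum]
  refine Finset.sum_subset (Finset.range_mono (by omega)) fun k _ hk => ?_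
  rw [Finset.mem_range, not_lt] at hk
  change (_ : ℂ) • coeff μ (Y ^ k) = 0
  rw [coeff_pow_eq_zero_of_degree_lt hY k μ (by omega), smul_zero]

/-- Truncated exponentials multiply over a square of exponents, the binomial theorem over a
triangle; terms outside the triangle vanish for degree reasons. -/
theorem sum_range_antidiagonal {M : Type*} [AddCommMonoid M] (N : ℕ) (F : ℕ → ℕ → M)
    (hF : ∀ i j, N < i + j → F i j = 0) :
    ∑ k ∈ Finset.range (N + 1), ∑ m ∈ Finset.HasAntidiagonal.antidiagonal k, F m.1 m.2 =
      ∑ i ∈ Finset.range (N + 1), ∑ j ∈ Finset.range (N + 1), F i j := by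
  rw [← Finset.sum_product',
    ← Finset.sum_filter_of_ne (p := fun x : ℕ × ℕ => x.1 + x.2 ∈ Finset.range (N + 1))]
  · rw [← Finset.sum_fiberwise_of_maps_to (g := fun x : ℕ × ℕ => x.1 + x.2)
      (t := Finset.range (N + 1)) (fun x hx => (Finset.mem_filter.1 hx).2)]
    refine Finset.sum_congr rfl fun k hk => Finset.sum_congr ?_ fun _ _ => rfl
    ext x
    simp only [Finset.HasAntidiagonal.mem_antidiagonal, Finset.mem_filter, Finset.mem_product, Finset.mem_range] at *
    omega
  · intro x _ hx
    rw [Finset.mem_range]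
    by_contra h
    exact hx (hF _ _ (by omega))

theorem expSeries_add {Y Z : MvPowerSeries σ (Module.End ℂ Fock)} (h : Commute Y Z)
    (hY : coeff 0 Y = 0) (hZ : coeff 0 Z = 0) :
    expSeries (Y + Z) = expSeries Y * expSeries Z := by
  classical
  ext1 μ
  set N := μ.degree with hN
  have h1 : coeff μ (expSeries Y * expSeries Z) = coeff μ (truncExp N Y * truncExp N Z) := by
    rw [coeff_mul, coeff_mul]
    refine Finset.sum_congr rfl fun p hp => ?_
    rw [Finset.HasAntidiagonal.mem_antidiagonal] at hp
    have : p.1.degree + p.2.degree = N := by rw [hN, ← hp, map_add]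
    rw [coeff_expSeries hY (show p.1.degree ≤ N by omega),
      coeff_expSeries hZ (show p.2.degree ≤ N by omega)]
  rw [h1, coeff_expSeries (by rw [map_add, hY, hZ, add_zero]) le_rfl, truncExp, truncExp, truncExp,
    Finset.sum_mul_sum]
  simp only [map_sum]
  rw [← sum_range_antidiagonal N (fun i j => coeff μ
    (((i.factorial : ℂ)⁻¹ • Y ^ i) * ((j.factorial : ℂ)⁻¹ • Z ^ j)))]
  · refine Finset.sum_congr rfl fun k _ => ?_
    rw [h.add_pow', Finset.smul_sum, map_sum]
    refine Finset.sum_congr rfl fun m hm => ?_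
    rw [Finset.HasAntidiagonal.mem_antidiagonal] at hm
    rw [smul_mul_smul_comm, ← Nat.cast_smul_eq_nsmul ℂ, smul_smul]
    congr 2
    rw [← hm]
    have h2 := Nat.add_choose_mul_factorial_mul_factorial m.1 m.2
    have h3 : (((m.1 + m.2).choose m.1 : ℕ) : ℂ) * m.1.factorial * m.2.factorial =
        (m.1 + m.2).factorial := by rw [Nat.choose_symm_add]; exact_mod_cast h2
    have e1 : ((m.1 + m.2).factorial : ℂ) ≠ 0 := by exact_mod_cast Nat.factorial_ne_zero _
    have e2 : (m.1.factorial : ℂ) ≠ 0 := by exact_mod_cast Nat.factorial_ne_zero _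
    have e3 : (m.2.factorial : ℂ) ≠ 0 := by exact_mod_cast Nat.factorial_ne_zero _
    field_simp
    linear_combination h3
  · intro i j hij
    rw [smul_mul_smul_comm]
    change (_ : ℂ) • coeff μ (Y ^ i * Z ^ j) = 0
    rw [coeff_mul_eq_zero (coeff_pow_eq_zero_of_degree_lt hY i) (coeff_pow_eq_zero_of_degree_lt hZ j) μ hij, smul_zero]

theorem coeff_pow_mem {S : Subalgebra ℂ (Module.End ℂ Fock)}
    {Y : MvPowerSeries σ (Module.End ℂ Fock)} (hY : ∀ μ, coeff μ Y ∈ S) (k : ℕ) :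
    ∀ μ, coeff μ (Y ^ k) ∈ S := by
  classical
  induction k with
  | zero =>
    intro μ
    rw [pow_zero, coeff_one]
    split_ifs
    · exact one_mem _
    · exact zero_mem _
  | succ k ih =>
    intro μ
    rw [pow_succ, coeff_mul]
    exact sum_mem fun p _ => mul_mem (ih _) (hY _)

theorem coeff_expSeries_mem {S : Subalgebra ℂ (Module.End ℂ Fock)}
    {Y : MvPowerSeries σ (Module.End ℂ Fock)} (hY : ∀ μ, coeff μ Y ∈ S) (μ : σ →₀ ℕ) :
    coeff μ (expSeries Y) ∈ S := by
  rw [coeff_expSeries_eq_sum]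
  exact sum_mem fun k _ => Subalgebra.smul_mem _ (coeff_pow_mem hY k μ) _

/-- The hat automorphism on power series. -/
abbrev hatSeries : MvPowerSeries σ (Module.End ℂ Fock) →+* MvPowerSeries σ (Module.End ℂ Fock) :=
  MvPowerSeries.map (hatOp : Module.End ℂ Fock →+* Module.End ℂ Fock)

theorem coeff_hatSeries (Y : MvPowerSeries σ (Module.End ℂ Fock)) (μ : σ →₀ ℕ) :
    coeff μ (hatSeries Y) = hatOp (coeff μ Y) := coeff_map _ _ _

theorem expSeries_hatSeries (Y : MvPowerSeries σ (Module.End ℂ Fock)) :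
    expSeries (hatSeries Y) = hatSeries (expSeries Y) := by
  ext1 μ
  rw [coeff_hatSeries, coeff_expSeries_eq_sum, coeff_expSeries_eq_sum, map_sum]
  refine Finset.sum_congr rfl fun k _ => ?_
  rw [map_smul, ← map_pow, coeff_hatSeries]

theorem commute_hatSeries {Y : MvPowerSeries σ (Module.End ℂ Fock)}
    (hY : ∀ μ, coeff μ Y ∈ localAlg b) : Commute Y (hatSeries Y) := by
  classical
  change Y * _ = _ * Y
  ext1 μ
  rw [coeff_mul, coeff_mul,
    Finsupp.sum_antidiagonal_swap μ fun p q => coeff p (hatSeries Y) * coeff q Y]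
  refine Finset.sum_congr rfl fun p _ => ?_
  rw [coeff_hatSeries]
  exact (localAlg_commute (hY _) (hatOp_mem_localAlg (hY _))).eq

/-- Families of times such that each monomial occurs in finitely many members only. -/
def FiniteTimes (t : ℕ+ → MvPowerSeries σ ℂ) : Prop :=
  (∀ i, coeff 0 (t i) = 0) ∧ ∀ μ, (Function.support fun i => coeff μ (t i)).Finite

theorem finiteTimes_X {g : ℕ+ → σ} (hg : Function.Injective g) :
    FiniteTimes fun i => (X (g i) : MvPowerSeries σ ℂ) := by
  classical
  refine ⟨fun i => coeff_zero_X _, fun μ => Set.Subsingleton.finite fun i hi j hj => ?_⟩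
  simp only [Function.mem_support, coeff_X, ne_eq, ite_eq_right_iff, one_ne_zero, imp_false,
    not_not] at hi hj
  exact hg (Finsupp.single_left_injective one_ne_zero (hi.symm.trans hj))

variable {t : ℕ+ → MvPowerSeries σ ℂ} (ht : FiniteTimes t)
include ht

theorem coeff_flow_mem {S : Subalgebra ℂ (Module.End ℂ Fock)} {A : ℕ+ → Module.End ℂ Fock}
    (hA : ∀ i, A i ∈ S) (μ : σ →₀ ℕ) : coeff μ (flow t A) ∈ S := by
  change ∑ᶠ i, coeff μ (t i) • A i ∈ S
  rw [finsum_eq_sum_of_support_subset _ (s := (ht.2 μ).toFinset)]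
  · exact sum_mem fun i _ => Subalgebra.smul_mem _ (hA i) _
  · intro i hi
    rw [Function.mem_support] at hi
    simp only [Set.Finite.coe_toFinset, Function.mem_support]
    exact fun h => hi (by rw [h, zero_smul])

theorem coeff_zero_flow (A : ℕ+ → Module.End ℂ Fock) : coeff 0 (flow t A) = 0 := by
  change ∑ᶠ i, coeff 0 (t i) • A i = 0
  simp only [ht.1, zero_smul, finsum_zero]

/-- Opposite times in the two components select `A i - C i`, exactly the combination that splits
into a current and its hat. -/
theorem flow_alpha {A C B : ℕ+ → Module.End ℂ Fock}
    (h : ∀ i, A i + (-1 : ℂ) • C i = B i + hatOp (B i)) :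
    flow t A + flow (-t) C = flow t B + hatSeries (flow t B) := by
  ext1 μ
  rw [map_add, map_add, coeff_hatSeries]
  have hf : ∀ D : ℕ+ → Module.End ℂ Fock,
      (Function.support fun i => coeff μ (t i) • D i).Finite := fun D =>
    (ht.2 μ).subset fun i hi => by
      rw [Function.mem_support] at hi ⊢
      exact fun h => hi (by rw [h, zero_smul])
  change ∑ᶠ i, coeff μ (t i) • A i + ∑ᶠ i, coeff μ (-t i) • C i =
    ∑ᶠ i, coeff μ (t i) • B i + hatOp (∑ᶠ i, coeff μ (t i) • B i)
  have h1 : hatOp (∑ᶠ i, coeff μ (t i) • B i) = ∑ᶠ i, coeff μ (t i) • hatOp (B i) := by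
    have := (hatOp : Module.End ℂ Fock →+* Module.End ℂ Fock).toAddMonoidHom.map_finsum (hf B)
    refine this.trans (finsum_congr fun i => ?_)
    exact map_smul hatOp _ _
  have h2 : ∀ i, coeff μ (-t i) • C i = coeff μ (t i) • ((-1 : ℂ) • C i) := fun i => by
    rw [map_neg, smul_smul, mul_neg_one]
  simp only [h1, h2]
  rw [← finsum_add_distrib (hf _) (hf _), ← finsum_add_distrib (hf _) (hf _)]
  refine finsum_congr fun i => ?_
  rw [← smul_add, ← smul_add, h]

theorem expSeries_flow_alpha {A C B : ℕ+ → Module.End ℂ Fock} (hB : ∀ i, B i ∈ localAlg b)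
    (h : ∀ i, A i + (-1 : ℂ) • C i = B i + hatOp (B i)) :
    expSeries (flow t A + flow (-t) C) =
      expSeries (flow t B) * hatSeries (expSeries (flow t B)) := by
  rw [flow_alpha ht h, expSeries_add (commute_hatSeries (coeff_flow_mem ht hB))
    (coeff_zero_flow ht _) (by rw [coeff_hatSeries, coeff_zero_flow ht, map_zero]),
    expSeries_hatSeries]

end PowerSeries

/-! ## The square of the tau function -/

/-- Regroups a left and a right splitting of the monomial, each cut in two, as a product of two
left-right series. -/
theorem sum_antidiagonal_four {A M : Type*} [AddCommMonoid A] [Finset.HasAntidiagonal A]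
    [AddCommMonoid M] (F : A → A → A → A → M) (μ : A) :
    ∑ p ∈ Finset.HasAntidiagonal.antidiagonal μ, ∑ u ∈ Finset.HasAntidiagonal.antidiagonal p.1, ∑ v ∈ Finset.HasAntidiagonal.antidiagonal p.2,
      F u.1 v.1 u.2 v.2 =
    ∑ p ∈ Finset.HasAntidiagonal.antidiagonal μ, ∑ u ∈ Finset.HasAntidiagonal.antidiagonal p.1, ∑ v ∈ Finset.HasAntidiagonal.antidiagonal p.2,
      F u.1 u.2 v.1 v.2 := by
  simp only [Finset.sum_sigma']
  refine Finset.sum_nbij'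
    (fun x => ⟨(x.2.1.1 + x.2.2.1, x.2.1.2 + x.2.2.2), (x.2.1.1, x.2.2.1), (x.2.1.2, x.2.2.2)⟩)
    (fun x => ⟨(x.2.1.1 + x.2.2.1, x.2.1.2 + x.2.2.2), (x.2.1.1, x.2.2.1), (x.2.1.2, x.2.2.2)⟩)
    ?_ ?_ ?_ ?_ ?_
  · rintro ⟨⟨p, q⟩, ⟨u, u'⟩, ⟨v, v'⟩⟩ h
    simp only [Finset.mem_sigma, Finset.HasAntidiagonal.mem_antidiagonal] at h ⊢
    obtain ⟨h1, h2, h3⟩ := h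
    exact ⟨by rw [← h1, ← h2, ← h3, add_add_add_comm], trivial, trivial⟩
  · rintro ⟨⟨p, q⟩, ⟨u, u'⟩, ⟨v, v'⟩⟩ h
    simp only [Finset.mem_sigma, Finset.HasAntidiagonal.mem_antidiagonal] at h ⊢
    obtain ⟨h1, h2, h3⟩ := h
    exact ⟨by rw [← h1, ← h2, ← h3, add_add_add_comm], trivial, trivial⟩
  · rintro ⟨⟨p, q⟩, ⟨u, u'⟩, ⟨v, v'⟩⟩ h
    simp only [Finset.mem_sigma, Finset.HasAntidiagonal.mem_antidiagonal] at h
    obtain ⟨h1, h2, h3⟩ := h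
    simp only [h2, h3]
  · rintro ⟨⟨p, q⟩, ⟨u, u'⟩, ⟨v, v'⟩⟩ h
    simp only [Finset.mem_sigma, Finset.HasAntidiagonal.mem_antidiagonal] at h
    obtain ⟨h1, h2, h3⟩ := h
    simp only [h2, h3]
  · intro x _
    rfl

theorem IsTranspose.exists_sum {ι : Type*} (s : Finset ι) {A : ι → Module.End ℂ Fock}
    (hA : ∀ i, ∃ A', IsTranspose (A i) A') :
    ∃ A' : ι → Module.End ℂ Fock, (∀ i, IsTranspose (A i) (A' i)) ∧
      IsTranspose (∑ i ∈ s, A i) (∑ i ∈ s, A' i) := by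
  choose A' hA' using hA
  refine ⟨A', hA', fun v w => ?_⟩
  simp [LinearMap.sum_apply, Finsupp.finsetSum_apply, hA' _ v w]

theorem pairing_sum {ι κ : Type*} (s : Finset ι) (r : Finset κ) {A : ι → Module.End ℂ Fock}
    (hA : ∀ i, ∃ A', IsTranspose (A i) A') (h : FormalOp) (x : κ → Fock) :
    pairing (vacBra ∘ₗ ∑ i ∈ s, A i) h (∑ j ∈ r, x j) =
      ∑ i ∈ s, ∑ j ∈ r, pairing (vacBra ∘ₗ A i) h (x j) := by
  obtain ⟨A', h1, h2⟩ := IsTranspose.exists_sum s hA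
  rw [pairing_eq_form h2, LinearMap.sum_apply]
  simp only [map_sum, LinearMap.sum_apply, pairing_eq_form (h1 _)]
  exact Finset.sum_comm

theorem pairing_smul (y z : ℂ) {A : Module.End ℂ Fock} (hA : ∃ A', IsTranspose A A')
    (h : FormalOp) (x : Fock) :
    pairing (y • (vacBra ∘ₗ A)) h (z • x) = y * z * pairing (vacBra ∘ₗ A) h x := by
  obtain ⟨A', hA⟩ := hA
  rw [← LinearMap.comp_smul, pairing_eq_form (hA.smul y), pairing_eq_form hA]
  simp only [LinearMap.smul_apply, map_smul, smul_eq_mul]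
  ring

-- Coefficient by coefficient, commuting the hatted factors past the unhatted ones turns each pair
-- of vectors into the form required by `pairing_prodFormal`; the resulting fourfold sum is the
-- Cauchy square.
open MvPowerSeries in
theorem matrixElement_sq {σ : Type*} [DecidableEq σ] {x : GroupExpr} {h : FormalOp}
    (hx : Value b x h) {L R : MvPowerSeries σ (Module.End ℂ Fock)}
    (hL : ∀ μ, coeff μ L ∈ rowFiniteAlg) (hR : ∀ μ, coeff μ R ∈ localAlg b) (n m : ℤ) :
    matrixElement (bra2 n (0 - n)) (L * hatSeries L) (prodFormal h (hatFormal h))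
        (R * hatSeries R) (ket2 m (0 - m)) =
      ((-1 : ℂ) ^ (n * (n - 1) / 2 + m * (m - 1) / 2)) •
        (matrixElement (braB n) L h R (ketB m)) ^ 2 := by
  ext1 μ
  have hbra := evenAlg_le_rowFiniteAlg (braOp_mem n)
  have hket := evenAlg_le_localAlg b (ketOp_mem m)
  have hterm : ∀ p q : σ →₀ ℕ,
      pairing (bra2 n (0 - n) ∘ₗ coeff p (L * hatSeries L)) (prodFormal h (hatFormal h))
        (coeff q (R * hatSeries R) (ket2 m (0 - m))) =
      ((-1 : ℂ) ^ (n * (n - 1) / 2 + m * (m - 1) / 2)) *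
        ∑ u ∈ Finset.HasAntidiagonal.antidiagonal p, ∑ v ∈ Finset.HasAntidiagonal.antidiagonal q,
          pairing (braB n ∘ₗ coeff u.1 L) h (coeff v.1 R (ketB m)) *
            pairing (braB n ∘ₗ coeff u.2 L) h (coeff v.2 R (ketB m)) := by
    intro p q
    have h1 : bra2 n (0 - n) ∘ₗ coeff p (L * hatSeries L) = (-1 : ℂ) ^ (n * (n - 1) / 2) •
        (vacBra ∘ₗ ∑ u ∈ Finset.HasAntidiagonal.antidiagonal p,
          (braOp n * coeff u.1 L) * hatOp (braOp n * coeff u.2 L)) := by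
      rw [bra2_eq, LinearMap.smul_comp, LinearMap.comp_assoc, coeff_mul]
      congr 2
      change braOp n * hatOp (braOp n) * _ = _
      rw [Finset.mul_sum]
      refine Finset.sum_congr rfl fun u _ => ?_
      -- The hatted bra operator must pass the unhatted evolution coefficient to join its own hatted
      -- one.
      have h2 := (localAlg_commute (hL u.1).1 (hatOp_mem_localAlg hbra.1)).eq
      rw [coeff_hatSeries, map_mul, mul_assoc, mul_assoc, ← mul_assoc (hatOp (braOp n)), ← h2,
        mul_assoc]
    have h3 : coeff q (R * hatSeries R) (ket2 m (0 - m)) = (-1 : ℂ) ^ (m * (m - 1) / 2) •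
        ∑ v ∈ Finset.HasAntidiagonal.antidiagonal q,
          (coeff v.1 R * ketOp m) (hatOp (coeff v.2 R * ketOp m) vac) := by
      rw [ket2_eq, map_smul, coeff_mul, LinearMap.sum_apply]
      congr 1
      refine Finset.sum_congr rfl fun v _ => ?_
      have h2 := congrArg (fun M : Module.End ℂ Fock => M (hatOp (ketOp m) vac))
        (localAlg_commute hket (hatOp_mem_localAlg (hR v.2))).eq
      simp only [Module.End.mul_apply] at h2
      rw [coeff_hatSeries, map_mul]
      simp only [Module.End.mul_apply]
      rw [h2]
    have htr : ∀ u : (σ →₀ ℕ) × (σ →₀ ℕ), ∃ A',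
        IsTranspose ((braOp n * coeff u.1 L) * hatOp (braOp n * coeff u.2 L)) A' := by
      intro u
      obtain ⟨_, A, _, hA⟩ := mul_mem hbra (hL u.1)
      obtain ⟨_, C, _, hC⟩ := mul_mem hbra (hL u.2)
      exact ⟨_, hA.mul (conj_isTranspose hC)⟩
    have htr' : ∃ A', IsTranspose (∑ u ∈ Finset.HasAntidiagonal.antidiagonal p,
        (braOp n * coeff u.1 L) * hatOp (braOp n * coeff u.2 L)) A' := by
      obtain ⟨A', _, h2⟩ := IsTranspose.exists_sum (Finset.HasAntidiagonal.antidiagonal p) htr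
      exact ⟨_, h2⟩
    rw [h1, h3, pairing_smul _ _ htr', pairing_sum _ _ htr, zpow_add₀ (by norm_num)]
    congr 1
    refine Finset.sum_congr rfl fun u _ => Finset.sum_congr rfl fun v _ => ?_
    rw [pairing_prodFormal hx (mul_mem hbra (hL u.1)) (mul_mem hbra (hL u.2))
      (mul_mem (hR v.1) hket) (mul_mem (hR v.2) hket), braB_eq, ketB_eq]
    rfl
  rw [pow_two]
  change ∑ p ∈ _, _ = (_ : ℂ) * coeff μ (_ * _)
  rw [coeff_mul]
  simp only [hterm]
  rw [← Finset.mul_sum, sum_antidiagonal_four fun p₁ q₁ p₂ q₂ =>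
    pairing (braB n ∘ₗ coeff p₁ L) h (coeff q₁ R (ketB m)) *
      pairing (braB n ∘ₗ coeff p₂ L) h (coeff q₂ R (ketB m))]
  congr 1
  refine Finset.sum_congr rfl fun p _ => ?_
  rw [← Finset.sum_mul_sum]
  rfl

end

end BKP

theorem mainTheorem2 (x : BKP.GroupExpr) (h : BKP.FormalOp) (hx : BKP.Value BKP.b x h) :
    ∃ hHat g : BKP.FormalOp, BKP.Value BKP.bHat x hHat ∧ BKP.IsProd h hHat g ∧
      ∀ n m : ℤ,
        (BKP.tauB n m BKP.sVar BKP.sbarVar h) ^ 2 =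
          ((-1 : ℂ) ^ (n * (n - 1) / 2 + m * (m - 1) / 2)) •
            BKP.tau2KP n m 0 BKP.sVar (-BKP.sVar) BKP.sbarVar (-BKP.sbarVar) g := by
  refine ⟨BKP.hatFormal h, BKP.prodFormal h (BKP.hatFormal h), hx.hatFormal,
    BKP.isProd_prodFormal hx hx.hatFormal, fun n m => ?_⟩
  have hs : BKP.FiniteTimes BKP.sVar := BKP.finiteTimes_X Sum.inl_injective
  have hsbar : BKP.FiniteTimes BKP.sbarVar := BKP.finiteTimes_X Sum.inr_injective
  have hi : ∀ i : ℕ+, ((i : ℕ) : ℤ) ≠ 0 := fun i => by exact_mod_cast i.ne_zero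
  have hi' : ∀ i : ℕ+, -((i : ℕ) : ℤ) ≠ 0 := fun i => neg_ne_zero.2 (hi i)
  unfold BKP.tau2KP
  rw [BKP.expSeries_flow_alpha hs (fun i => BKP.beta_mem_localAlg (hi i))
      fun i => BKP.alpha_sub (hi i),
    BKP.expSeries_flow_alpha hsbar (fun i => BKP.beta_mem_localAlg (hi' i))
      fun i => BKP.alpha_sub (hi' i),
    BKP.matrixElement_sq hx
      (BKP.coeff_expSeries_mem (BKP.coeff_flow_mem hs fun i => BKP.beta_mem_rowFiniteAlg (hi i)))
      (BKP.coeff_expSeries_mem (BKP.coeff_flow_mem hsbar fun i => BKP.beta_mem_localAlg (hi' i))),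
    -- The sign squares to `1`, so it may stand on either side of the identity.
    smul_smul, ← mul_zpow, neg_one_mul, neg_neg, one_zpow, one_smul]
  rfl
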